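/- Let $\nu\ge 2$ and let $f$ be a real-valued function on $\mathbb R^\nu$ that is $C^\infty$ and even ($f(-k)=f(k)$) in a neighbourhood of $0$. Suppose that the kernel of the second differential of $f$ at $0$ is exactly the coordinate plane $\{k_3=\dots=k_\nu=0\}$ (so $0$ is a critical point of co-rank $2$). For signs $\varepsilon,\eta\in\{+1,-1\}$, the germ of $f$ at $0$ is said to be of class $X_{e,5}^{\varepsilon\eta}$ if there are $a,d\in\mathbb R$ with $a^2\ne4$ in case $\varepsilon=\eta$, a nondegenerate quadratic form $Q$ in $\nu-2$ variables, and a germ at $0$ of a $C^\infty$ diffeomorphism $k\mapsto\tilde k$ of $\mathbb R^\nu$ that fixes $0$ and is odd, such that near $0$ $$f(k)=d+\varepsilon\tilde k_1^4+a\,\tilde k_1^2\tilde k_2^2+\eta\,\tilde k_2^4+Q(\tilde k_3,\dots,\tilde k_\nu).$$ Put $$A=\frac1{4!}\frac{\partial^4f(0)}{\partial k_1^4},\quad B=\frac1{3!}\frac{\partial^4f(0)}{\partial k_1^3\partial k_2},\quad C=\frac14\frac{\partial^4f(0)}{\partial k_1^2\partial k_2^2},\quad D=\frac1{3!}\frac{\partial^4f(0)}{\partial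 k_1\partial k_2^3},\quad E=\frac1{4!}\frac{\partial^4f(0)}{\partial k_2^4},$$ $$\begin{aligned}\Delta_4={}&-4(AC^3D^2+B^3D^3+B^2C^3E)-27(A^2D^4+B^4E^2)+B^2C^2D^2+18(ABCD^3+B^3CDE)\\&+144(A^2CD^2E+AB^2CE^2)-6AB^2D^2E-80ABC^2DE-192A^2BDE^2+16AE(C^2-4AE)^2.\end{aligned}$$ Then the germ of $f$ at $0$ is of class $X_{e,5}^{\varepsilon\eta}$ for some signs $\varepsilon,\eta$ if and only if $\Delta_4\ne0$. Moreover, if $\Delta_4>0$ then it is of class $X_{e,5}^{++}$ or of class $X_{e,5}^{--}$, and if $\Delta_4<0$ then it is of class $X_{e,5}^{+-}$. -/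

import Mathlib

open Filter Topology
open scoped ContDiff

/-- `f` is smooth near the origin, i.e. it represents a germ at `0` of a `C^∞` map. -/
def SmoothNearZero {E F : Type*} [NormedAddCommGroup E] [NormedSpace ℝ E]
    [NormedAddCommGroup F] [NormedSpace ℝ F] (f : E → F) : Prop :=
  ∀ᶠ x in 𝓝 (0 : E), ContDiffAt ℝ ∞ f x

/-- `f` is even near the origin. -/
def EvenNearZero {E : Type*} [NormedAddCommGroup E] (f : E → ℝ) : Prop :=
  ∀ᶠ x in 𝓝 (0 : E), f (-x) = f x

/-- `h` represents the germ at `0` of a smooth odd change of variables: a germ of a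
diffeomorphism with `h 0 = 0` and `h (-x) = -h x`. -/
structure IsOddDiffeoGerm {E : Type*} [NormedAddCommGroup E] [NormedSpace ℝ E]
    (h : E → E) : Prop where
  map_zero : h 0 = 0
  odd : ∀ᶠ x in 𝓝 (0 : E), h (-x) = -h x
  smooth : SmoothNearZero h
  exists_inverse : ∃ g : E → E, g 0 = 0 ∧ SmoothNearZero g ∧
    (∀ᶠ x in 𝓝 (0 : E), g (h x) = x) ∧ (∀ᶠ y in 𝓝 (0 : E), h (g y) = y)

/-- Right-odd equivalence of germs at `0`: `f₁ ∘ h⁻¹ = f₂` as germs,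
written as `f₁ = f₂ ∘ h`, for a smooth odd change of variables `h`. -/
def ROEquivalent {E : Type*} [NormedAddCommGroup E] [NormedSpace ℝ E]
    (f₁ f₂ : E → ℝ) : Prop :=
  ∃ h : E → E, IsOddDiffeoGerm h ∧ f₁ =ᶠ[𝓝 0] f₂ ∘ h

/-- The second differential of `f` at the origin, as a bilinear form. -/
noncomputable def secondDifferential {E : Type*} [NormedAddCommGroup E] [NormedSpace ℝ E]
    (f : E → ℝ) : E →L[ℝ] E →L[ℝ] ℝ :=
  fderiv ℝ (fderiv ℝ f) 0

/-- The function `d + ε x₁⁴ + a x₁² x₂² + η x₂⁴ + Q(x₃, …, x_ν)` on `ℝ^ν`, `ν = m + 2`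
(the coordinates `x₁, x₂` are `x 0, x 1`). -/
noncomputable def xe5NormalForm {m : ℕ} (ε η : ℤˣ) (a d : ℝ)
    (Q : QuadraticForm ℝ (Fin m → ℝ)) (x : Fin (m + 2) → ℝ) : ℝ :=
  d + ((ε : ℤ) : ℝ) * x 0 ^ 4 + a * x 0 ^ 2 * x 1 ^ 2 + ((η : ℤ) : ℝ) * x 1 ^ 4
    + Q (fun i => x i.succ.succ)

/-- The germ of `f` at `0` has an even singularity of class `X_{e,5}^{εη}`: up to a smooth odd
change of variables, an additive constant and a nondegenerate quadratic form in the remaining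
variables, it is `ε x⁴ + a x² y² + η y⁴` with `a² ≠ 4` when the two signs agree. -/
def IsXe5 {m : ℕ} (ε η : ℤˣ) (f : (Fin (m + 2) → ℝ) → ℝ) : Prop :=
  ∃ (a d : ℝ) (Q : QuadraticForm ℝ (Fin m → ℝ)),
    (ε = η → a ^ 2 ≠ 4) ∧ Q.Nondegenerate ∧
      ROEquivalent f (xe5NormalForm ε η a d Q)

/-- The partial derivative `∂⁴f(0) / ∂k_{i₁} ∂k_{i₂} ∂k_{i₃} ∂k_{i₄}`. -/
noncomputable def partialFour {n : ℕ} (f : (Fin n → ℝ) → ℝ) (i₁ i₂ i₃ i₄ : Fin n) : ℝ :=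
  iteratedFDeriv ℝ 4 f 0
    ![Pi.single i₁ 1, Pi.single i₂ 1, Pi.single i₃ 1, Pi.single i₄ 1]

/-- The discriminant of the binary quartic form
`A x⁴ + B x³ y + C x² y² + D x y³ + E y⁴`. -/
def quarticDiscriminant (A B C D E : ℝ) : ℝ :=
  -4 * (A * C ^ 3 * D ^ 2 + B ^ 3 * D ^ 3 + B ^ 2 * C ^ 3 * E)
    - 27 * (A ^ 2 * D ^ 4 + B ^ 4 * E ^ 2) + B ^ 2 * C ^ 2 * D ^ 2
    + 18 * (A * B * C * D ^ 3 + B ^ 3 * C * D * E)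
    + 144 * (A ^ 2 * C * D ^ 2 * E + A * B ^ 2 * C * E ^ 2)
    - 6 * A * B ^ 2 * D ^ 2 * E - 80 * A * B * C ^ 2 * D * E
    - 192 * A ^ 2 * B * D * E ^ 2 + 16 * A * E * (C ^ 2 - 4 * A * E) ^ 2

/-- `Δ₄` for the fourth-order Taylor coefficients of `f` at `0` in the first two variables. -/
noncomputable def deltaFour {m : ℕ} (f : (Fin (m + 2) → ℝ) → ℝ) : ℝ :=
  quarticDiscriminant
    (1 / 24 * partialFour f 0 0 0 0)
    (1 / 6 * partialFour f 0 0 0 1)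
    (1 / 4 * partialFour f 0 0 1 1)
    (1 / 6 * partialFour f 0 1 1 1)
    (1 / 24 * partialFour f 1 1 1 1)

/-!
The germ `f` is studied through its quadratic part, whose kernel is the coordinate plane of
`k₁, k₂`, and the quartic form `P` on this plane given by its fourth differential. As `f` is even,
there are no cubic terms, so `P` is well defined under odd changes of variables: such a change acts
on `P` through the restriction of its derivative at `0` to the plane. The discriminant of a binary
quartic is a relative invariant of weight `12` (`quarticDiscriminant_comp`), hence it is nonzero
in the class `X_{e,5}` (`linearlyEquivalent_of_isXe5`). The quadratic part and `P` are handled as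
limits of `(f (s k) - f 0) / s ^ n` for `n = 2, 4`, which avoids the chain rule of higher order.

Conversely, a real binary quartic with nonzero discriminant is linearly equivalent to
`ε x⁴ + a x² y² + η y⁴` (`exists_normalQuartic`). A quartic is the product of two real quadratic
forms, which can be chosen, by means of the largest root of the resolvent cubic, so that their
resultant is positive. Then the Jacobian of the two factors has two distinct real roots, and these
are directions which diagonalise both factors. The sign of the discriminant of
`ε x⁴ + a x² y² + η y⁴` is `ε η`, which gives the signs in the statement.

It remains to remove the terms of higher order (`exists_oddDiffeo_normalForm`). By Hadamard's lemma
an even smooth `f` is the sum of its constant term, `P`, the quadratic form `B (z, z)` and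
combinations, with smooth even coefficients, of the sextic monomials in `(x, y)`, of cubic monomials
in `(x, y)` times `z`, and of products of two components of `z` with coefficients vanishing at `0`
(`exists_even_expansion`). The change of variables is sought as `z + τ z + ∑ σᵢ mᵢ` in the variables
`z`, where `mᵢ` are the cubic monomials, and as a displacement of `(x, y)` along cubic vector fields.
Matching coefficients turns the problem into implicit equations for the unknown smooth even
functions, in which `k` is a parameter, and which the implicit function theorem solves
(`exists_morse_family`, `exists_linear_family`, `exists_sextic_absorption`). The linearised equation
is invertible because every sextic form lies in the ideal generated by the partial derivatives of
the normal form (`sexticMap_injective`). No flow of a vector field is needed.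
-/

/-! ### Binary quartic forms -/

/-- The binary quartic form with coefficients `A, B, C, D, E`, as a function of two variables. -/
def binaryQuartic (A B C D E x y : ℝ) : ℝ :=
  A * x ^ 4 + B * x ^ 3 * y + C * x ^ 2 * y ^ 2 + D * x * y ^ 3 + E * y ^ 4

lemma binaryQuartic_injective {A B C D E A' B' C' D' E' : ℝ}
    (h : ∀ x y, binaryQuartic A B C D E x y = binaryQuartic A' B' C' D' E' x y) :
    A = A' ∧ B = B' ∧ C = C' ∧ D = D' ∧ E = E' := by
  have h1 := h 1 0
  have h2 := h 0 1
  have h3 := h 1 1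
  have h4 := h 1 (-1)
  have h5 := h 2 1
  simp only [binaryQuartic] at h1 h2 h3 h4 h5
  refine ⟨?_, ?_, ?_, ?_, ?_⟩ <;> linarith

/-- The invariant of degree two of a binary quartic form. -/
def quarticInvariantI (A B C D E : ℝ) : ℝ := 12 * A * E - 3 * B * D + C ^ 2

/-- The invariant of degree three of a binary quartic form. -/
def quarticInvariantJ (A B C D E : ℝ) : ℝ :=
  72 * A * C * E + 9 * B * C * D - 27 * A * D ^ 2 - 27 * E * B ^ 2 - 2 * C ^ 3

lemma quarticDiscriminant_eq_invariants (A B C D E : ℝ) :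
    27 * quarticDiscriminant A B C D E =
      4 * quarticInvariantI A B C D E ^ 3 - quarticInvariantJ A B C D E ^ 2 := by
  simp only [quarticDiscriminant, quarticInvariantI, quarticInvariantJ]
  ring

/-- The discriminant is a relative invariant of weight `12` of linear substitutions. It is
enough to check this for the two generating invariants, of weights `4` and `6`. -/
lemma quarticDiscriminant_comp {A B C D E A' B' C' D' E' p q r s : ℝ}
    (h : ∀ x y, binaryQuartic A B C D E (p * x + q * y) (r * x + s * y) =
      binaryQuartic A' B' C' D' E' x y) :
    quarticDiscriminant A' B' C' D' E' =
      (p * s - q * r) ^ 12 * quarticDiscriminant A B C D E := by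
  obtain ⟨hA, hB, hC, hD, hE⟩ := binaryQuartic_injective
    (A := A * p ^ 4 + B * p ^ 3 * r + C * p ^ 2 * r ^ 2 + D * p * r ^ 3 + E * r ^ 4)
    (B := 4 * A * p ^ 3 * q + B * (p ^ 3 * s + 3 * p ^ 2 * q * r)
      + 2 * C * (p ^ 2 * r * s + p * q * r ^ 2) + D * (3 * p * r ^ 2 * s + q * r ^ 3)
      + 4 * E * r ^ 3 * s)
    (C := 6 * A * p ^ 2 * q ^ 2 + 3 * B * (p ^ 2 * q * s + p * q ^ 2 * r)
      + C * (p ^ 2 * s ^ 2 + 4 * p * q * r * s + q ^ 2 * r ^ 2)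
      + 3 * D * (p * r * s ^ 2 + q * r ^ 2 * s) + 6 * E * r ^ 2 * s ^ 2)
    (D := 4 * A * p * q ^ 3 + B * (3 * p * q ^ 2 * s + q ^ 3 * r)
      + 2 * C * (p * q * s ^ 2 + q ^ 2 * r * s) + D * (p * s ^ 3 + 3 * q * r * s ^ 2)
      + 4 * E * r * s ^ 3)
    (E := A * q ^ 4 + B * q ^ 3 * s + C * q ^ 2 * s ^ 2 + D * q * s ^ 3 + E * s ^ 4)
    (A' := A') (B' := B') (C' := C') (D' := D') (E' := E')
    (fun x y => by rw [← h x y]; simp only [binaryQuartic]; ring)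
  have hI : quarticInvariantI A' B' C' D' E' =
      (p * s - q * r) ^ 4 * quarticInvariantI A B C D E := by
    rw [← hA, ← hB, ← hC, ← hD, ← hE]
    simp only [quarticInvariantI]
    ring
  have hJ : quarticInvariantJ A' B' C' D' E' =
      (p * s - q * r) ^ 6 * quarticInvariantJ A B C D E := by
    rw [← hA, ← hB, ← hC, ← hD, ← hE]
    simp only [quarticInvariantJ]
    ring
  have h1 := quarticDiscriminant_eq_invariants A' B' C' D' E'
  have h2 := quarticDiscriminant_eq_invariants A B C D E
  rw [hI, hJ] at h1
  linear_combination (1 / 27) * h1 - (1 / 27) * (p * s - q * r) ^ 12 * h2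

/-- `P'` arises from `P` by an invertible linear substitution of the two variables. -/
def LinearlyEquivalent (P P' : ℝ → ℝ → ℝ) : Prop :=
  ∃ p q r s : ℝ, p * s - q * r ≠ 0 ∧ ∀ x y, P (p * x + q * y) (r * x + s * y) = P' x y

lemma LinearlyEquivalent.trans {P P' P'' : ℝ → ℝ → ℝ} (h : LinearlyEquivalent P P')
    (h' : LinearlyEquivalent P' P'') : LinearlyEquivalent P P'' := by
  obtain ⟨p, q, r, s, hd, h⟩ := h
  obtain ⟨p', q', r', s', hd', h'⟩ := h'
  refine ⟨p * p' + q * r', p * q' + q * s', r * p' + s * r', r * q' + s * s', ?_, fun x y => ?_⟩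
  · have := mul_ne_zero hd hd'
    intro h0
    apply this
    linear_combination h0
  · rw [← h', ← h]
    congr 1 <;> ring

/-- A binary quartic form with nonzero discriminant takes a nonzero value; a rotation and
dilation makes this value the leading coefficient. -/
lemma exists_leading_ne_zero {A B C D E : ℝ} (h : quarticDiscriminant A B C D E ≠ 0) :
    ∃ A' B' C' D' E' : ℝ, A' ≠ 0 ∧
      LinearlyEquivalent (binaryQuartic A B C D E) (binaryQuartic A' B' C' D' E') := by
  have hv : ∃ x y, binaryQuartic A B C D E x y ≠ 0 := by
    by_contra! hv
    obtain ⟨rfl, rfl, rfl, rfl, rfl⟩ := binaryQuartic_injective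
      (A' := 0) (B' := 0) (C' := 0) (D' := 0) (E' := 0)
      (fun x y => (hv x y).trans (by simp [binaryQuartic]))
    simp [quarticDiscriminant] at h
  obtain ⟨a, b, hab⟩ := hv
  refine ⟨binaryQuartic A B C D E a b,
    -4 * A * a ^ 3 * b + B * (a ^ 4 - 3 * a ^ 2 * b ^ 2) + 2 * C * (a ^ 3 * b - a * b ^ 3)
      + D * (3 * a ^ 2 * b ^ 2 - b ^ 4) + 4 * E * a * b ^ 3,
    6 * A * a ^ 2 * b ^ 2 + 3 * B * (-a ^ 3 * b + a * b ^ 3)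
      + C * (a ^ 4 - 4 * a ^ 2 * b ^ 2 + b ^ 4) + 3 * D * (a ^ 3 * b - a * b ^ 3)
      + 6 * E * a ^ 2 * b ^ 2,
    -4 * A * a * b ^ 3 + B * (3 * a ^ 2 * b ^ 2 - b ^ 4) + 2 * C * (-a ^ 3 * b + a * b ^ 3)
      + D * (a ^ 4 - 3 * a ^ 2 * b ^ 2) + 4 * E * a ^ 3 * b,
    binaryQuartic A B C D E (-b) a, hab, a, -b, b, a, ?_, fun x y => ?_⟩
  · intro h0
    have ha : a = 0 := by nlinarith [sq_nonneg a, sq_nonneg b]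
    have hb : b = 0 := by nlinarith [sq_nonneg a, sq_nonneg b]
    simp [ha, hb, binaryQuartic] at hab
  · simp only [binaryQuartic]
    ring

/-- A real cubic `X³ + 2uX² + (u² - 4w)X - v²` with `v ≠ 0` has a largest root; it is positive
and the derivative there is nonnegative. -/
lemma exists_resolvent_root (u v w : ℝ) (hv : v ≠ 0) :
    ∃ S : ℝ, 0 < S ∧ S ^ 3 + 2 * u * S ^ 2 + (u ^ 2 - 4 * w) * S = v ^ 2 ∧
      0 ≤ 3 * S ^ 2 + 4 * u * S + (u ^ 2 - 4 * w) := by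
  set g : ℝ → ℝ := fun S => S ^ 3 + 2 * u * S ^ 2 + (u ^ 2 - 4 * w) * S - v ^ 2 with hg
  have hgc : Continuous g := by fun_prop
  have hv2 : 0 < v ^ 2 := by positivity
  set M : ℝ := 1 + 2 * |u| + |u ^ 2 - 4 * w| + v ^ 2 with hM
  have hpos : ∀ S, M ≤ S → 0 < g S := by
    intro S hS
    have h1 := abs_nonneg u
    have h2 := abs_nonneg (u ^ 2 - 4 * w)
    have hS1 : 1 ≤ S := by linarith
    have h3 : -(2 * |u|) * S ^ 2 ≤ 2 * u * S ^ 2 := by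
      have := neg_abs_le u
      nlinarith [sq_nonneg S]
    have h4 : -|u ^ 2 - 4 * w| * S ^ 2 ≤ (u ^ 2 - 4 * w) * S := by
      have := neg_abs_le (u ^ 2 - 4 * w)
      nlinarith [mul_nonneg h2 (by nlinarith : 0 ≤ S ^ 2 - S)]
    have h5 : v ^ 2 ≤ v ^ 2 * S ^ 2 := le_mul_of_one_le_right hv2.le (one_le_pow₀ hS1)
    have h6 : S ^ 3 ≥ M * S ^ 2 := by nlinarith [sq_nonneg S]
    simp only [hg]
    nlinarith
  have hM0 : 0 ≤ M := by positivity
  have hcpt : IsCompact (Set.Icc 0 M ∩ g ⁻¹' Set.Iic 0) :=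
    isCompact_Icc.inter_right (isClosed_Iic.preimage hgc)
  have hg0 : g 0 < 0 := by simp only [hg]; nlinarith
  obtain ⟨S, ⟨⟨hS0, hSM⟩, hSg⟩, hSmax⟩ := hcpt.exists_isGreatest
    ⟨0, ⟨le_refl _, hM0⟩, hg0.le⟩
  have hafter : ∀ x, S < x → 0 < g x := by
    intro x hx
    by_contra! hgx
    rcases le_total M x with h | h
    · exact absurd (hpos x h) (not_lt.mpr hgx)
    · exact absurd (hSmax ⟨⟨hS0.trans hx.le, h⟩, hgx⟩) (not_le.mpr hx)
  have hge : 0 ≤ g S := by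
    refine ge_of_tendsto (hgc.continuousAt.tendsto.mono_left (nhdsWithin_le_nhds (s := Set.Ioi S)))
      ?_
    filter_upwards [self_mem_nhdsWithin] with x hx using (hafter x hx).le
  have hz : g S = 0 := le_antisymm hSg hge
  have hSpos : 0 < S := by
    rcases hS0.eq_or_lt with h | h
    · rw [← h] at hz
      exact absurd hz hg0.ne
    · exact h
  refine ⟨S, hSpos, by simp only [hg] at hz; linarith, ?_⟩
  have hc : Continuous fun x : ℝ =>
      x ^ 2 + x * S + S ^ 2 + 2 * u * (x + S) + (u ^ 2 - 4 * w) := by fun_prop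
  have := ge_of_tendsto (hc.continuousAt (x := S) |>.tendsto.mono_left
    (nhdsWithin_le_nhds (s := Set.Ioi S))) (b := 0) (by
      filter_upwards [self_mem_nhdsWithin] with x hx
      have h1 := hafter x hx
      have h2 : g x - g S = (x - S) *
        (x ^ 2 + x * S + S ^ 2 + 2 * u * (x + S) + (u ^ 2 - 4 * w)) := by simp only [hg]; ring
      have h3 : 0 < x - S := sub_pos.mpr hx
      rw [hz, sub_zero] at h2
      rw [h2] at h1
      exact (pos_of_mul_pos_right h1 h3.le).le)
  linarith

/-- A depressed quartic with nonzero discriminant becomes biquadratic after a linear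
substitution: the largest root of the resolvent cubic splits it into two real quadratic factors
with positive resultant, and these can be diagonalised simultaneously. -/
lemma depressed_linearlyEquivalent_biquadratic {A u v w : ℝ}
    (h : quarticDiscriminant A 0 (A * u) (A * v) (A * w) ≠ 0) :
    ∃ α β γ : ℝ, LinearlyEquivalent (binaryQuartic A 0 (A * u) (A * v) (A * w))
      (binaryQuartic α 0 γ 0 β) := by
  rcases eq_or_ne v 0 with rfl | hv
  · exact ⟨A, A * w, A * u, 1, 0, 0, 1, by norm_num, fun x y => by simp⟩
  obtain ⟨S, hS, hres, hder⟩ := exists_resolvent_root u v w hv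
  obtain ⟨σ, hσ, rfl⟩ : ∃ σ : ℝ, 0 < σ ∧ S = σ ^ 2 :=
    ⟨√S, Real.sqrt_pos.mpr hS, (Real.sq_sqrt hS.le).symm⟩
  -- the factors are `x² + σ x y + t y²` and `x² - σ x y + t' y²`
  set t : ℝ := (u + σ ^ 2 - v / σ) / 2 with ht
  set t' : ℝ := (u + σ ^ 2 + v / σ) / 2 with ht'
  have hσ0 : σ ≠ 0 := hσ.ne'
  have e1 : t + t' = u + σ ^ 2 := by rw [ht, ht']; ring
  have e2 : σ * (t' - t) = v := by rw [ht, ht']; field_simp; ring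
  have e3 : t * t' = w := by
    have : (4 * σ ^ 2) * (t * t') = (4 * σ ^ 2) * w := by
      rw [ht, ht']; field_simp; linear_combination hres
    exact mul_left_cancel₀ (by positivity) this
  clear_value t t'
  obtain rfl : u = t + t' - σ ^ 2 := by linarith
  subst e2 e3
  -- the derivative of the resolvent cubic at its root is the resultant of the two factors
  have hR : 3 * (σ ^ 2) ^ 2 + 4 * (t + t' - σ ^ 2) * σ ^ 2
      + ((t + t' - σ ^ 2) ^ 2 - 4 * (t * t')) = (t' - t) ^ 2 + 2 * σ ^ 2 * (t + t') := by ring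
  rw [hR] at hder
  have hdisc : quarticDiscriminant A 0 (A * (t + t' - σ ^ 2)) (A * (σ * (t' - t))) (A * (t * t'))
      = A ^ 6 * (σ ^ 2 - 4 * t) * (σ ^ 2 - 4 * t') *
        ((t' - t) ^ 2 + 2 * σ ^ 2 * (t + t')) ^ 2 := by
    simp only [quarticDiscriminant]; ring
  have hRpos : 0 < (t' - t) ^ 2 + 2 * σ ^ 2 * (t + t') := by
    refine lt_of_le_of_ne hder fun h0 => h ?_
    rw [hdisc, ← h0]; ring
  set δ : ℝ := √((t' - t) ^ 2 + 2 * σ ^ 2 * (t + t')) with hδ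
  have hδ2 : δ ^ 2 = (t' - t) ^ 2 + 2 * σ ^ 2 * (t + t') := Real.sq_sqrt hder
  have hδpos : 0 < δ := Real.sqrt_pos.mpr hRpos
  -- the diagonalising directions are the roots of the Jacobian of the two factors
  set ρ : ℝ := ((t' - t) + δ) / (2 * σ) with hρ
  set ρ' : ℝ := ((t' - t) - δ) / (2 * σ) with hρ'
  have s1 : σ * (ρ + ρ') = t' - t := by rw [hρ, hρ']; field_simp; ring
  have s2 : 2 * (ρ * ρ') = -(t + t') := by
    have : (2 * σ ^ 2) * (2 * (ρ * ρ')) = (2 * σ ^ 2) * (-(t + t')) := by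
      rw [hρ, hρ']; field_simp; linear_combination -hδ2
    exact mul_left_cancel₀ (by positivity) this
  have s3 : ρ - ρ' ≠ 0 := by
    have : ρ - ρ' = δ / σ := by rw [hρ, hρ']; field_simp; ring
    rw [this]; positivity
  refine ⟨A * (ρ ^ 2 + σ * ρ + t) * (ρ ^ 2 - σ * ρ + t'),
    A * (ρ' ^ 2 + σ * ρ' + t) * (ρ' ^ 2 - σ * ρ' + t'),
    A * ((ρ ^ 2 + σ * ρ + t) * (ρ' ^ 2 - σ * ρ' + t')
      + (ρ' ^ 2 + σ * ρ' + t) * (ρ ^ 2 - σ * ρ + t')), ρ, ρ', 1, 1, ?_, fun x y => ?_⟩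
  · simpa using s3
  · have f0 : ∀ X Y : ℝ, binaryQuartic A 0 (A * (t + t' - σ ^ 2)) (A * (σ * (t' - t)))
        (A * (t * t')) X Y = A * (X ^ 2 + σ * X * Y + t * Y ^ 2) *
          (X ^ 2 - σ * X * Y + t' * Y ^ 2) := by
      intro X Y; simp only [binaryQuartic]; ring
    have f1 : (ρ * x + ρ' * y) ^ 2 + σ * (ρ * x + ρ' * y) * (1 * x + 1 * y)
        + t * (1 * x + 1 * y) ^ 2 = (ρ ^ 2 + σ * ρ + t) * x ^ 2 + (ρ' ^ 2 + σ * ρ' + t) * y ^ 2 := by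
      linear_combination x * y * (s1 + s2)
    have f2 : (ρ * x + ρ' * y) ^ 2 - σ * (ρ * x + ρ' * y) * (1 * x + 1 * y)
        + t' * (1 * x + 1 * y) ^ 2
        = (ρ ^ 2 - σ * ρ + t') * x ^ 2 + (ρ' ^ 2 - σ * ρ' + t') * y ^ 2 := by
      linear_combination x * y * (-s1 + s2)
    rw [f0, f1, f2]
    simp only [binaryQuartic]
    ring

/-- The quartic part of the normal form with signs `ε`, `η`, as a binary form. -/
def normalQuartic (ε η : ℤˣ) (a : ℝ) : ℝ → ℝ → ℝ :=
  binaryQuartic ((ε : ℤ) : ℝ) 0 a 0 ((η : ℤ) : ℝ)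

lemma exists_pow_four_scaling {α : ℝ} (h : α ≠ 0) :
    ∃ (c : ℝ) (ε : ℤˣ), c ≠ 0 ∧ α * c ^ 4 = ((ε : ℤ) : ℝ) := by
  have hc : ((|α| ^ (1 / 4 : ℝ))⁻¹) ^ 4 = |α|⁻¹ := by
    rw [inv_pow, ← Real.rpow_natCast, ← Real.rpow_mul (abs_nonneg α)]
    norm_num
  have h0 : (|α| ^ (1 / 4 : ℝ))⁻¹ ≠ 0 :=
    inv_ne_zero (Real.rpow_pos_of_pos (abs_pos.mpr h) _).ne'
  rcases lt_or_gt_of_ne h with hn | hp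
  · exact ⟨_, -1, h0, by rw [hc, abs_of_neg hn]; push_cast; field_simp⟩
  · exact ⟨_, 1, h0, by rw [hc, abs_of_pos hp]; push_cast; field_simp⟩

/-- Every binary quartic form with nonzero discriminant is linearly equivalent to a
normal form. -/
lemma exists_normalQuartic {A B C D E : ℝ} (h : quarticDiscriminant A B C D E ≠ 0) :
    ∃ (ε η : ℤˣ) (a : ℝ),
      LinearlyEquivalent (binaryQuartic A B C D E) (normalQuartic ε η a) := by
  obtain ⟨A', B', C', D', E', hA, h1⟩ := exists_leading_ne_zero h
  have hd1 : quarticDiscriminant A' B' C' D' E' ≠ 0 := by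
    obtain ⟨p, q, r, s, hps, h1⟩ := h1
    rw [quarticDiscriminant_comp h1]
    exact mul_ne_zero (pow_ne_zero _ hps) h
  obtain ⟨b, hb⟩ : ∃ b, b = B' / (4 * A') := ⟨_, rfl⟩
  have hB' : B' = 4 * A' * b := by rw [hb]; field_simp
  obtain ⟨u, v, w, h2⟩ : ∃ u v w, LinearlyEquivalent (binaryQuartic A' B' C' D' E')
      (binaryQuartic A' 0 (A' * u) (A' * v) (A' * w)) := by
    refine ⟨(6 * A' * b ^ 2 - 3 * B' * b + C') / A',
      (-4 * A' * b ^ 3 + 3 * B' * b ^ 2 - 2 * C' * b + D') / A',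
      (A' * b ^ 4 - B' * b ^ 3 + C' * b ^ 2 - D' * b + E') / A', 1, -b, 0, 1, by norm_num,
      fun x y => ?_⟩
    rw [mul_div_cancel₀ _ hA, mul_div_cancel₀ _ hA, mul_div_cancel₀ _ hA, hB']
    simp only [binaryQuartic]
    ring
  have hd2 : quarticDiscriminant A' 0 (A' * u) (A' * v) (A' * w) ≠ 0 := by
    obtain ⟨p, q, r, s, hps, h2⟩ := h2
    rw [quarticDiscriminant_comp h2]
    exact mul_ne_zero (pow_ne_zero _ hps) hd1
  obtain ⟨α, β, γ, h3⟩ := depressed_linearlyEquivalent_biquadratic hd2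
  have hd3 : quarticDiscriminant α 0 γ 0 β ≠ 0 := by
    obtain ⟨p, q, r, s, hps, h3⟩ := h3
    rw [quarticDiscriminant_comp h3]
    exact mul_ne_zero (pow_ne_zero _ hps) hd2
  have hα : α ≠ 0 := by rintro rfl; simp [quarticDiscriminant] at hd3
  have hβ : β ≠ 0 := by rintro rfl; simp [quarticDiscriminant] at hd3
  obtain ⟨c, ε, hc, hε⟩ := exists_pow_four_scaling hα
  obtain ⟨e, η, he, hη⟩ := exists_pow_four_scaling hβ
  refine ⟨ε, η, γ * c ^ 2 * e ^ 2, (h1.trans h2).trans (h3.trans ?_)⟩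
  refine ⟨c, 0, 0, e, by simpa using ⟨hc, he⟩, fun x y => ?_⟩
  rw [normalQuartic, ← hε, ← hη]
  simp only [binaryQuartic]
  ring

lemma sq_intCast_units (ε : ℤˣ) : (((ε : ℤ) : ℝ)) ^ 2 = 1 := by
  rcases Int.units_eq_one_or ε with rfl | rfl <;> norm_num

/-- The discriminant of the normal form. -/
lemma quarticDiscriminant_normal (ε η : ℤˣ) (a : ℝ) :
    quarticDiscriminant ((ε : ℤ) : ℝ) 0 a 0 ((η : ℤ) : ℝ) =
      16 * (((ε * η : ℤˣ) : ℤ) : ℝ) * (a ^ 2 - 4 * (((ε * η : ℤˣ) : ℤ) : ℝ)) ^ 2 := by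
  push_cast
  simp only [quarticDiscriminant]
  ring

lemma quarticDiscriminant_normal_ne_zero {ε η : ℤˣ} {a : ℝ} (h : ε = η → a ^ 2 ≠ 4) :
    quarticDiscriminant ((ε : ℤ) : ℝ) 0 a 0 ((η : ℤ) : ℝ) ≠ 0 := by
  rw [quarticDiscriminant_normal]
  rcases eq_or_ne ε η with rfl | hne
  · have : a ^ 2 - 4 ≠ 0 := sub_ne_zero.mpr (h rfl)
    simpa using this
  · have : ε * η = -1 := by
      rcases Int.units_eq_one_or ε with rfl | rfl <;>
      rcases Int.units_eq_one_or η with rfl | rfl <;> simp_all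
    rw [this]
    have : a ^ 2 + 4 ≠ 0 := by positivity
    simpa using this

/-! ### Smooth implicit functions -/

section Implicit

variable {X Y Y' : Type*} [NormedAddCommGroup X] [NormedSpace ℝ X] [CompleteSpace X]
  [NormedAddCommGroup Y] [NormedSpace ℝ Y] [CompleteSpace Y]
  [NormedAddCommGroup Y'] [NormedSpace ℝ Y'] [CompleteSpace Y']

/-- The implicit function theorem for germs that are smooth on a neighbourhood, with smoothness
of the solution on a neighbourhood and local uniqueness. -/
lemma exists_smooth_implicit (Φ : X → Y → Y') (y₀ : Y) (L : Y ≃L[ℝ] Y')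
    (hΦ : ∀ᶠ v in 𝓝 ((0 : X), y₀), ContDiffAt ℝ ∞ (fun w : X × Y => Φ w.1 w.2) v)
    (hL : HasFDerivAt (Φ 0) (L : Y →L[ℝ] Y') y₀) (h0 : Φ 0 y₀ = 0) :
    ∃ p : X → Y, p 0 = y₀ ∧ SmoothNearZero p ∧ (∀ᶠ x in 𝓝 0, Φ x (p x) = 0) ∧
      ∀ᶠ v in 𝓝 ((0 : X), y₀), Φ v.1 v.2 = 0 → p v.1 = v.2 := by
  set f : X × Y → Y' := fun w => Φ w.1 w.2 with hf
  have hne : (∞ : WithTop ℕ∞) ≠ 0 := by simp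
  have cdf : ContDiffAt ℝ ∞ f ((0 : X), y₀) := hΦ.self_of_nhds
  have hpart : fderiv ℝ f ((0 : X), y₀) ∘L .inr ℝ X Y = L := by
    have h1 : HasFDerivAt (fun y : Y => ((0 : X), y)) (.inr ℝ X Y) y₀ :=
      hasFDerivAt_prodMk_right 0 y₀
    have h2 := (cdf.differentiableAt hne).hasFDerivAt.comp y₀ h1
    exact h2.unique hL
  have inv : (fderiv ℝ f ((0 : X), y₀) ∘L .inr ℝ X Y).IsInvertible := hpart ▸ ⟨L, rfl⟩
  set p := cdf.implicitFunction hne inv with hp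
  have hp0 : p 0 = y₀ := cdf.implicitFunction_apply_self hne inv
  have hpc : ContinuousAt p 0 := (cdf.contDiffAt_implicitFunction hne inv).continuousAt
  have huniq := cdf.eventually_apply_eq_iff_implicitFunction hne inv
  have hf0 : f ((0 : X), y₀) = 0 := h0
  have hsol : ∀ᶠ x in 𝓝 (0 : X), f (x, p x) = 0 := by
    simpa [hf0] using cdf.eventually_apply_implicitFunction hne inv
  have hgraph : Tendsto (fun x => (x, p x)) (𝓝 0) (𝓝 ((0 : X), y₀)) := by
    have := (continuousAt_id (x := (0 : X))).prodMk hpc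
    simpa [ContinuousAt, hp0] using this
  have hinv : ∀ᶠ v in 𝓝 ((0 : X), y₀), (fderiv ℝ f v ∘L .inr ℝ X Y).IsInvertible := by
    have hc : ContinuousAt (fun v => fderiv ℝ f v ∘L .inr ℝ X Y) ((0 : X), y₀) := by
      have : ContinuousAt (fderiv ℝ f) ((0 : X), y₀) :=
        (cdf.fderiv_right (m := ∞) (by simp)).continuousAt
      exact this.clm_comp continuousAt_const
    have := ContinuousLinearEquiv.nhds L
    rw [← hpart] at this
    exact hc.eventually this
  refine ⟨p, hp0, ?_, hsol, ?_⟩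
  -- `C^∞` at a point gives no neighbourhood on which a function is `C^∞`, so the theorem is applied
  -- again at each point of the graph, where by uniqueness it yields the same germ
  · filter_upwards [hgraph.eventually hΦ, hgraph.eventually hinv, hsol,
      hgraph.eventually huniq.eventually_nhds] with x hx1 hx2 hx3 hx4
    have hsm := hx1.contDiffAt_implicitFunction hne hx2
    have hq0 : hx1.implicitFunction hne hx2 x = p x := hx1.implicitFunction_apply_self hne hx2
    have hqsol := hx1.eventually_apply_implicitFunction hne hx2
    have hqt : Tendsto (fun x' => (x', hx1.implicitFunction hne hx2 x')) (𝓝 x) (𝓝 (x, p x)) := by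
      have := (continuousAt_id (x := x)).prodMk hsm.continuousAt
      simpa [ContinuousAt, hq0] using this
    refine hsm.congr_of_eventuallyEq ?_
    filter_upwards [hqsol, hqt.eventually hx4] with x' h1 h2
    exact h2.mp (by rw [hf0, h1]; exact hx3)
  · filter_upwards [huniq] with v hv hv0
    exact hv.mp (by rw [hf0]; exact hv0)

/-- The solution of an implicit equation that is even in the parameter is even. -/
lemma exists_even_implicit (Φ : X → Y → Y') (y₀ : Y) (L : Y ≃L[ℝ] Y')
    (hΦ : ∀ᶠ v in 𝓝 ((0 : X), y₀), ContDiffAt ℝ ∞ (fun w : X × Y => Φ w.1 w.2) v)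
    (hL : HasFDerivAt (Φ 0) (L : Y →L[ℝ] Y') y₀) (h0 : Φ 0 y₀ = 0)
    (heven : ∀ᶠ x in 𝓝 (0 : X), ∀ y, Φ (-x) y = Φ x y) :
    ∃ p : X → Y, p 0 = y₀ ∧ SmoothNearZero p ∧ (∀ᶠ x in 𝓝 0, p (-x) = p x) ∧
      ∀ᶠ x in 𝓝 0, Φ x (p x) = 0 := by
  obtain ⟨p, hp0, hps, hsol, huniq⟩ := exists_smooth_implicit Φ y₀ L hΦ hL h0
  refine ⟨p, hp0, hps, ?_, hsol⟩
  have hneg : Tendsto (fun x : X => -x) (𝓝 0) (𝓝 0) := by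
    simpa using (continuous_neg (G := X)).tendsto 0
  have hpc : Tendsto p (𝓝 0) (𝓝 y₀) := hp0 ▸ hps.self_of_nhds.continuousAt.tendsto
  have hg : Tendsto (fun x : X => (x, p (-x))) (𝓝 0) (𝓝 ((0 : X), y₀)) :=
    tendsto_id.prodMk_nhds (hpc.comp hneg)
  filter_upwards [heven, hneg.eventually hsol, hg.eventually huniq] with x h1 h2 h3
  exact (h3 (by rw [← h1]; exact h2)).symm

/-- A smooth odd germ with `h 0 = 0` and with identity derivative at `0` is a germ of an odd
diffeomorphism. -/
lemma IsOddDiffeoGerm.of_hasFDerivAt_id {h : X → X} (h0 : h 0 = 0)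
    (hodd : ∀ᶠ x in 𝓝 (0 : X), h (-x) = -h x) (hs : SmoothNearZero h)
    (hd : HasFDerivAt h (ContinuousLinearMap.id ℝ X) 0) : IsOddDiffeoGerm h := by
  refine ⟨h0, hodd, hs, ?_⟩
  obtain ⟨g, hg0, hgs, hsol, huniq⟩ := exists_smooth_implicit (fun y x : X => h x - y) 0
    (ContinuousLinearEquiv.refl ℝ X)
    (by
      have : Tendsto (Prod.snd : X × X → X) (𝓝 ((0 : X), (0 : X))) (𝓝 0) :=
        continuous_snd.tendsto _
      filter_upwards [this.eventually hs] with v hv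
      exact (hv.comp v contDiffAt_snd).sub contDiffAt_fst)
    (by simpa using hd) (by simp [h0])
  refine ⟨g, hg0, hgs, ?_, ?_⟩
  · have hc : Tendsto (fun x => (h x, x)) (𝓝 0) (𝓝 ((0 : X), (0 : X))) := by
      have h1 : Tendsto h (𝓝 0) (𝓝 0) := by
        simpa [ContinuousAt, h0] using hd.continuousAt
      exact h1.prodMk_nhds tendsto_id
    filter_upwards [hc.eventually huniq] with x hx using hx (by simp)
  · filter_upwards [hsol] with y hy using sub_eq_zero.mp hy

end Implicit

/-! ### Hadamard's lemma -/

section Hadamard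

universe u

/-- Differentiation under the integral sign: integrals of smooth functions over a compact
interval depend smoothly on parameters. -/
lemma contDiff_integral_of_contDiff {E F : Type u} [NormedAddCommGroup E] [NormedSpace ℝ E]
    [FiniteDimensional ℝ E] [NormedAddCommGroup F] [NormedSpace ℝ F] [CompleteSpace F]
    {H : E × ℝ → F} (hH : ContDiff ℝ ∞ H) : ContDiff ℝ ∞ fun x => ∫ t in (0 : ℝ)..1, H (x, t) := by
  rw [contDiff_infty]
  intro n
  induction n generalizing F with
  | zero =>
    rw [Nat.cast_zero, contDiff_zero]
    exact intervalIntegral.continuous_parametric_intervalIntegral_of_continuous'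
      (f := fun x t => H (x, t)) hH.continuous 0 1
  | succ n ih =>
    rw [Nat.cast_add, Nat.cast_one, contDiff_succ_iff_hasFDerivAt]
    have hH' : ContDiff ℝ ∞ fun w : E × ℝ => fderiv ℝ H w ∘L .inl ℝ E ℝ :=
      (hH.fderiv_right (m := ∞) (by simp)).clm_comp contDiff_const
    refine ⟨fun x => ∫ t in (0 : ℝ)..1, fderiv ℝ H (x, t) ∘L .inl ℝ E ℝ, ih hH', fun x => ?_⟩
    have hcpt : IsCompact (Metric.closedBall x 1 ×ˢ Set.uIcc (0 : ℝ) 1) :=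
      (isCompact_closedBall x 1).prod isCompact_uIcc
    obtain ⟨C, hC⟩ := hcpt.exists_bound_of_continuousOn hH'.continuous.continuousOn
    refine intervalIntegral.hasFDerivAt_integral_of_dominated_of_fderiv_le
      (F := fun x t => H (x, t)) (F' := fun x t => fderiv ℝ H (x, t) ∘L .inl ℝ E ℝ)
      (bound := fun _ => C) (Metric.closedBall_mem_nhds x one_pos) ?_ ?_ ?_ ?_ ?_ ?_
    · exact Eventually.of_forall fun y =>
        (hH.continuous.comp (by fun_prop : Continuous fun t : ℝ => (y, t))).aestronglyMeasurable
    · exact (hH.continuous.comp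
        (by fun_prop : Continuous fun t : ℝ => (x, t))).intervalIntegrable _ _
    · exact (hH'.continuous.comp
        (by fun_prop : Continuous fun t : ℝ => (x, t))).aestronglyMeasurable
    · exact Eventually.of_forall fun t ht y hy =>
        hC (y, t) ⟨hy, Set.uIoc_subset_uIcc ht⟩
    · exact intervalIntegrable_const
    · refine Eventually.of_forall fun t _ y _ => ?_
      have h1 : HasFDerivAt (fun z : E => (z, t)) (.inl ℝ E ℝ) y := hasFDerivAt_prodMk_left y t
      exact (hH.differentiable (by simp) (y, t)).hasFDerivAt.comp y h1

/-- Hadamard's lemma relative to a linear map `π`: a smooth `g` differs from `g ∘ π` by a smooth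
family of linear maps applied to `k - π k`. If `g` has parity `c = ±1`, the family has the
opposite parity. -/
lemma exists_hadamard {E F : Type u} [NormedAddCommGroup E] [NormedSpace ℝ E]
    [FiniteDimensional ℝ E] [NormedAddCommGroup F] [NormedSpace ℝ F] [CompleteSpace F]
    {g : E → F} (hg : ContDiff ℝ ∞ g) (π : E →L[ℝ] E) (c : ℝ) (hc : ∀ k, g (-k) = c • g k) :
    ∃ G : E → E →L[ℝ] F, ContDiff ℝ ∞ G ∧ (∀ k, G (-k) = (-c) • G k) ∧
      ∀ k, g k = g (π k) + G k (k - π k) := by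
  have hg' : ContDiff ℝ ∞ (fderiv ℝ g) := hg.fderiv_right (m := ∞) (by simp)
  have hpath : ContDiff ℝ ∞ fun w : E × ℝ => π w.1 + w.2 • (w.1 - π w.1) := by fun_prop
  have hsm := hg'.comp hpath
  refine ⟨fun k => ∫ t in (0 : ℝ)..1, fderiv ℝ g (π k + t • (k - π k)),
    contDiff_integral_of_contDiff hsm, fun k => ?_, fun k => ?_⟩
  · have hpar : ∀ x, fderiv ℝ g (-x) = (-c) • fderiv ℝ g x := by
      intro x
      have h1 : HasFDerivAt (fun y => g (-y)) (-fderiv ℝ g (-x)) x := by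
        have h := (hg.differentiable (by simp) (-x)).hasFDerivAt.comp x
          ((hasFDerivAt_id x).neg)
        convert! h using 1
        ext v; simp
      have h2 : HasFDerivAt (fun y => g (-y)) (c • fderiv ℝ g x) x := by
        simp_rw [hc]
        exact (hg.differentiable (by simp) x).hasFDerivAt.const_smul c
      rw [neg_smul, ← h1.unique h2, neg_neg]
    rw [← intervalIntegral.integral_smul]
    refine intervalIntegral.integral_congr fun t _ => ?_
    rw [← hpar]
    congr 1
    simp only [map_neg]
    module
  · have hcont : Continuous fun t : ℝ => fderiv ℝ g (π k + t • (k - π k)) :=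
      hg'.continuous.comp (by fun_prop)
    have hderiv : ∀ t : ℝ, HasDerivAt (fun t : ℝ => g (π k + t • (k - π k)))
        (fderiv ℝ g (π k + t • (k - π k)) (k - π k)) t := by
      intro t
      have h1 : HasDerivAt (fun t : ℝ => π k + t • (k - π k)) (k - π k) t := by
        simpa using ((hasDerivAt_id t).smul_const (k - π k)).const_add (π k)
      exact (hg.differentiable (by simp) _).hasFDerivAt.comp_hasDerivAt t h1
    have hint := intervalIntegral.integral_eq_sub_of_hasDerivAt (a := (0 : ℝ)) (b := 1)
      (fun t _ => hderiv t) ((hcont.clm_apply continuous_const).intervalIntegrable _ _)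
    rw [ContinuousLinearMap.intervalIntegral_apply (hcont.intervalIntegrable _ _), hint]
    simp

/-- A smooth odd function of two variables is `x a + y b` with `a`, `b` smooth and even. -/
lemma exists_hadamard_odd {F : Type} [NormedAddCommGroup F] [NormedSpace ℝ F] [CompleteSpace F]
    {g : ℝ × ℝ → F} (hg : ContDiff ℝ ∞ g) (hodd : ∀ u, g (-u) = -g u) :
    ∃ a b : ℝ × ℝ → F, ContDiff ℝ ∞ a ∧ ContDiff ℝ ∞ b ∧ (∀ u, a (-u) = a u) ∧
      (∀ u, b (-u) = b u) ∧ ∀ u, g u = u.1 • a u + u.2 • b u := by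
  obtain ⟨G, hG, hGe, h⟩ := exists_hadamard hg 0 (-1) (by simpa using hodd)
  refine ⟨fun u => G u (1, 0), fun u => G u (0, 1), hG.clm_apply contDiff_const,
    hG.clm_apply contDiff_const, fun u => by simp [hGe], fun u => by simp [hGe], fun u => ?_⟩
  have h0 : g 0 = 0 := by
    have := hodd 0
    rw [neg_zero] at this
    have h2 : (2 : ℝ) • g 0 = 0 := by
      rw [two_smul]
      nth_rw 1 [this]
      simp
    exact (smul_eq_zero.mp h2).resolve_left two_ne_zero
  rw [h u, ← map_smul, ← map_smul, ← map_add]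
  simp [h0]

/-- A smooth even function of two variables is `g 0 + x² a + x y b + y² c` with smooth even
coefficients. -/
lemma exists_hadamard_even {F : Type} [NormedAddCommGroup F] [NormedSpace ℝ F] [CompleteSpace F]
    {g : ℝ × ℝ → F} (hg : ContDiff ℝ ∞ g) (heven : ∀ u, g (-u) = g u) :
    ∃ a b c : ℝ × ℝ → F, (ContDiff ℝ ∞ a ∧ ContDiff ℝ ∞ b ∧ ContDiff ℝ ∞ c) ∧
      ((∀ u, a (-u) = a u) ∧ (∀ u, b (-u) = b u) ∧ (∀ u, c (-u) = c u)) ∧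
      ∀ u, g u = g 0 + (u.1 ^ 2 • a u + (u.1 * u.2) • b u + u.2 ^ 2 • c u) := by
  obtain ⟨G, hG, hGe, h⟩ := exists_hadamard hg 0 1 (by simpa using heven)
  obtain ⟨a₁, b₁, ha₁, hb₁, ha₁e, hb₁e, h₁⟩ := exists_hadamard_odd
    (g := fun u => G u (1, 0)) (hG.clm_apply contDiff_const) (fun u => by simp [hGe])
  obtain ⟨a₂, b₂, ha₂, hb₂, ha₂e, hb₂e, h₂⟩ := exists_hadamard_odd
    (g := fun u => G u (0, 1)) (hG.clm_apply contDiff_const) (fun u => by simp [hGe])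
  refine ⟨a₁, fun u => b₁ u + a₂ u, b₂, ⟨ha₁, hb₁.add ha₂, hb₂⟩,
    ⟨ha₁e, fun u => by simp [hb₁e, ha₂e], hb₂e⟩, fun u => ?_⟩
  have hu : G u u = u.1 • G u (1, 0) + u.2 • G u (0, 1) := by
    rw [← map_smul, ← map_smul, ← map_add]
    simp
  have := h u
  simp only [zero_apply, sub_zero] at this
  rw [this, hu, h₁, h₂]
  module

end Hadamard

/-! ### Taylor expansion with smooth coefficients -/

lemma eq_of_tendsto_div_pow {n : ℕ} {φ ψ : ℝ → ℝ} {l : ℝ}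
    (h : Tendsto (fun s => φ s / s ^ n) (𝓝[≠] 0) (𝓝 l)) (hψ : ContinuousAt ψ 0)
    (heq : ∀ s, φ s = s ^ n * ψ s) : l = ψ 0 := by
  refine tendsto_nhds_unique h ((hψ.tendsto.mono_left nhdsWithin_le_nhds).congr' ?_)
  filter_upwards [self_mem_nhdsWithin] with s hs
  have : s ≠ 0 := hs
  rw [heq]
  field_simp

lemma tendsto_div_sq_of_tendsto_div_pow_four {φ : ℝ → ℝ} {l : ℝ}
    (h : Tendsto (fun s => φ s / s ^ 4) (𝓝[≠] 0) (𝓝 l)) :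
    Tendsto (fun s => φ s / s ^ 2) (𝓝[≠] 0) (𝓝 0) := by
  have h2 : Tendsto (fun s : ℝ => s ^ 2) (𝓝[≠] 0) (𝓝 0) := by
    have : Tendsto (fun s : ℝ => s ^ 2) (𝓝 0) (𝓝 (0 ^ 2)) := (continuous_pow 2).tendsto 0
    simpa using this.mono_left nhdsWithin_le_nhds
  have := h.mul h2
  rw [mul_zero] at this
  refine this.congr' ?_
  filter_upwards [self_mem_nhdsWithin] with s hs
  have : s ≠ 0 := hs
  field_simp

/-- An even smooth function of two variables with given quartic leading part: the remainder is a
combination of the sextic monomials with smooth even coefficients. -/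
lemma exists_sextic_remainder {g : ℝ × ℝ → ℝ} (hg : ContDiff ℝ ∞ g) (heven : ∀ u, g (-u) = g u)
    {A B C D E : ℝ} (h4 : ∀ u : ℝ × ℝ, Tendsto (fun s : ℝ => (g (s • u) - g 0) / s ^ 4) (𝓝[≠] 0)
      (𝓝 (binaryQuartic A B C D E u.1 u.2))) :
    ∃ R : ℝ × ℝ → Fin 7 → ℝ, ContDiff ℝ ∞ R ∧ (∀ u, R (-u) = R u) ∧
      ∀ u, g u = g 0 + binaryQuartic A B C D E u.1 u.2
        + ∑ i : Fin 7, u.1 ^ (6 - i : ℕ) * u.2 ^ (i : ℕ) * R u i := by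
  obtain ⟨p, q, r, ⟨hp, hq, hr⟩, ⟨hpe, hqe, hre⟩, h⟩ := exists_hadamard_even hg heven
  have hline : ∀ u : ℝ × ℝ, Continuous fun s : ℝ => s • u := fun u => by fun_prop
  have hquad : ∀ x y : ℝ, 0 = x ^ 2 * p 0 + x * y * q 0 + y ^ 2 * r 0 := by
    intro x y
    have hc : Continuous fun s : ℝ => x ^ 2 * p (s • (x, y)) + x * y * q (s • (x, y))
        + y ^ 2 * r (s • (x, y)) := by
      have h1 := hp.continuous.comp (hline (x, y))
      have h2 := hq.continuous.comp (hline (x, y))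
      have h3 := hr.continuous.comp (hline (x, y))
      exact ((continuous_const.mul h1).add (continuous_const.mul h2)).add (continuous_const.mul h3)
    have := eq_of_tendsto_div_pow (tendsto_div_sq_of_tendsto_div_pow_four (h4 (x, y)))
      hc.continuousAt (fun s => by
        rw [h (s • (x, y))]
        simp only [Prod.smul_mk, smul_eq_mul]
        ring)
    simpa using this
  have hp0 : p 0 = 0 := by simpa using (hquad 1 0).symm
  have hr0 : r 0 = 0 := by simpa using (hquad 0 1).symm
  have hq0 : q 0 = 0 := by simpa [hp0, hr0] using (hquad 1 1).symm
  obtain ⟨p₁, p₂, p₃, ⟨hp₁, hp₂, hp₃⟩, ⟨hpe₁, hpe₂, hpe₃⟩, hp'⟩ := exists_hadamard_even hp hpe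
  obtain ⟨q₁, q₂, q₃, ⟨hq₁, hq₂, hq₃⟩, ⟨hqe₁, hqe₂, hqe₃⟩, hq'⟩ := exists_hadamard_even hq hqe
  obtain ⟨r₁, r₂, r₃, ⟨hr₁, hr₂, hr₃⟩, ⟨hre₁, hre₂, hre₃⟩, hr'⟩ := exists_hadamard_even hr hre
  -- the five coefficients of the quartic monomials
  obtain ⟨c, hc, hce, hgc⟩ : ∃ c : Fin 5 → ℝ × ℝ → ℝ, (∀ i, ContDiff ℝ ∞ (c i)) ∧
      (∀ i u, c i (-u) = c i u) ∧ ∀ u, g u = g 0 +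
        binaryQuartic (c 0 u) (c 1 u) (c 2 u) (c 3 u) (c 4 u) u.1 u.2 := by
    refine ⟨![p₁, fun u => p₂ u + q₁ u, fun u => p₃ u + q₂ u + r₁ u, fun u => q₃ u + r₂ u, r₃],
      fun i => ?_, fun i u => ?_, fun u => ?_⟩
    · fin_cases i
      exacts [hp₁, hp₂.add hq₁, (hp₃.add hq₂).add hr₁, hq₃.add hr₂, hr₃]
    · fin_cases i <;>
        simp [hpe₁, hpe₂, hpe₃, hqe₁, hqe₂, hqe₃, hre₁, hre₂, hre₃]
    · rw [h u, hp' u, hq' u, hr' u, hp0, hq0, hr0]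
      simp [binaryQuartic]
      ring
  have hquart : ∀ x y : ℝ, binaryQuartic A B C D E x y =
      binaryQuartic (c 0 0) (c 1 0) (c 2 0) (c 3 0) (c 4 0) x y := by
    intro x y
    have hcc : Continuous fun s : ℝ => binaryQuartic (c 0 (s • (x, y))) (c 1 (s • (x, y)))
        (c 2 (s • (x, y))) (c 3 (s • (x, y))) (c 4 (s • (x, y))) x y := by
      have := fun i => (hc i).continuous.comp (hline (x, y))
      simp only [binaryQuartic]
      exact ((((((this 0).mul continuous_const).add (((this 1).mul continuous_const).mul
        continuous_const)).add (((this 2).mul continuous_const).mul continuous_const)).add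
        (((this 3).mul continuous_const).mul continuous_const)).add
        ((this 4).mul continuous_const))
    have := eq_of_tendsto_div_pow (h4 (x, y)) hcc.continuousAt (fun s => by
        rw [hgc (s • (x, y))]
        simp only [Prod.smul_mk, smul_eq_mul, binaryQuartic]
        ring)
    simpa using this
  obtain ⟨e0, e1, e2, e3, e4⟩ := binaryQuartic_injective hquart
  choose a b d hsm hev hexp using fun i => exists_hadamard_even (hc i) (hce i)
  refine ⟨fun u => ![a 0 u, b 0 u + a 1 u, d 0 u + b 1 u + a 2 u, d 1 u + b 2 u + a 3 u,
    d 2 u + b 3 u + a 4 u, d 3 u + b 4 u, d 4 u], ?_, fun u => ?_, fun u => ?_⟩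
  · have h1 := fun i => (hsm i).1
    have h2 := fun i => (hsm i).2.1
    have h3 := fun i => (hsm i).2.2
    rw [contDiff_pi]
    intro i
    fin_cases i
    exacts [h1 0, (h2 0).add (h1 1), ((h3 0).add (h2 1)).add (h1 2),
      ((h3 1).add (h2 2)).add (h1 3), ((h3 2).add (h2 3)).add (h1 4), (h3 3).add (h2 4), h3 4]
  · simp only [fun i => (hev i).1 u, fun i => (hev i).2.1 u, fun i => (hev i).2.2 u]
  · rw [hgc u, hexp 0 u, hexp 1 u, hexp 2 u, hexp 3 u, hexp 4 u, ← e0, ← e1, ← e2, ← e3, ← e4]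
    simp [Fin.sum_univ_succ, binaryQuartic]
    ring

section Splitting

variable {Z : Type} [NormedAddCommGroup Z] [NormedSpace ℝ Z] [FiniteDimensional ℝ Z]

/-- The expansion of an even smooth function of `(u, z)`, with `u` in the plane, whose quadratic
part is `B` and whose restriction to the plane starts with a quartic form. -/
lemma exists_even_expansion {F : (ℝ × ℝ) × Z → ℝ} (hF : ContDiff ℝ ∞ F)
    (heven : ∀ k, F (-k) = F k) (B : Z →L[ℝ] Z →L[ℝ] ℝ)
    (h2 : ∀ k : (ℝ × ℝ) × Z, Tendsto (fun s : ℝ => (F (s • k) - F 0) / s ^ 2) (𝓝[≠] 0)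
      (𝓝 (B k.2 k.2)))
    {a₀ a₁ a₂ a₃ a₄ : ℝ}
    (h4 : ∀ u : ℝ × ℝ, Tendsto (fun s : ℝ => (F (s • (u, 0)) - F 0) / s ^ 4) (𝓝[≠] 0)
      (𝓝 (binaryQuartic a₀ a₁ a₂ a₃ a₄ u.1 u.2))) :
    ∃ (R : ℝ × ℝ → Fin 7 → ℝ) (S : Fin 4 → ℝ × ℝ → Z →L[ℝ] ℝ)
      (T : (ℝ × ℝ) × Z → Z →L[ℝ] Z →L[ℝ] ℝ),
      (ContDiff ℝ ∞ R ∧ (∀ i, ContDiff ℝ ∞ (S i)) ∧ ContDiff ℝ ∞ T) ∧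
      ((∀ u, R (-u) = R u) ∧ (∀ i u, S i (-u) = S i u) ∧ ∀ k, T (-k) = T k) ∧ T 0 = 0 ∧
      ∀ k : (ℝ × ℝ) × Z, F k = F 0 + binaryQuartic a₀ a₁ a₂ a₃ a₄ k.1.1 k.1.2
        + ∑ i : Fin 7, k.1.1 ^ (6 - i : ℕ) * k.1.2 ^ (i : ℕ) * R k.1 i
        + ∑ i : Fin 4, k.1.1 ^ (3 - i : ℕ) * k.1.2 ^ (i : ℕ) * S i k.1 k.2
        + B k.2 k.2 + T k k.2 k.2 := by
  set π : (ℝ × ℝ) × Z →L[ℝ] (ℝ × ℝ) × Z := .inl ℝ _ _ ∘L .fst ℝ _ _ with hπ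
  have hπk : ∀ k, π k = (k.1, 0) := fun k => rfl
  have hkπ : ∀ k, k - π k = (0, k.2) := fun k => by rw [hπk]; ext <;> simp
  obtain ⟨G, hG, hGo, hFG⟩ := exists_hadamard hF π 1 (by simpa using heven)
  set g : (ℝ × ℝ) × Z → Z →L[ℝ] ℝ := fun k => G k ∘L .inr ℝ _ _ with hg
  have hgs : ContDiff ℝ ∞ g := hG.clm_comp contDiff_const
  have hgo : ∀ k, g (-k) = (-1 : ℝ) • g k := fun k => by
    ext z
    simp [hg, hGo]
  obtain ⟨G', hG', hGe', hgG⟩ := exists_hadamard hgs π (-1) hgo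
  obtain ⟨T, hTs, hTe, hTG⟩ : ∃ T : (ℝ × ℝ) × Z → Z →L[ℝ] Z →L[ℝ] ℝ, ContDiff ℝ ∞ T ∧
      (∀ k, T (-k) = T k) ∧ ∀ k z, G' k (0, z) = T k z :=
    ⟨fun k => G' k ∘L .inr ℝ _ _, hG'.clm_comp contDiff_const,
      fun k => by simp only [hGe', neg_neg, one_smul], fun k z => rfl⟩
  have hin : ContDiff ℝ ∞ fun u : ℝ × ℝ => ((u, 0) : (ℝ × ℝ) × Z) := by fun_prop
  have hneg : ∀ u : ℝ × ℝ, ((-u, 0) : (ℝ × ℝ) × Z) = -(u, 0) := fun u => by simp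
  obtain ⟨a, b, ha, hb, hae, hbe, hab⟩ := exists_hadamard_odd (g := fun u => g (u, 0))
    (hgs.comp hin) (fun u => by
      have := hgo (u, 0)
      rw [← hneg] at this
      rw [this]
      ext z
      simp)
  have hexp : ∀ k, F k = F (k.1, 0) + (k.1.1 * a k.1 k.2 + k.1.2 * b k.1 k.2) + T k k.2 k.2 := by
    intro k
    have e1 : G k (0, k.2) = g k k.2 := rfl
    rw [hFG k, hkπ, e1, hgG k, hkπ, hTG, hπk, hab k.1]
    simp
    ring
  have h00 : F ((0 : ℝ × ℝ), 0) = F 0 := rfl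
  obtain ⟨R, hR, hRe, hFR⟩ := exists_sextic_remainder (g := fun u => F (u, 0)) (hF.comp hin)
    (fun u => by rw [hneg, heven]) (A := a₀) (B := a₁) (C := a₂) (D := a₃) (E := a₄)
    (fun u => by simpa [h00] using h4 u)
  simp only [h00] at hFR
  -- comparison of the second order terms
  have hquad : ∀ (x y : ℝ) (z : Z), B z z = x * a 0 z + y * b 0 z + T 0 z z := by
    intro x y z
    set k : (ℝ × ℝ) × Z := ((x, y), z) with hk
    have hl : Continuous fun s : ℝ => s • k := by fun_prop
    have hl1 : Continuous fun s : ℝ => s • (x, y) := by fun_prop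
    have c1 : Continuous fun s : ℝ => a (s • (x, y)) z :=
      (ha.continuous.comp hl1).clm_apply continuous_const
    have c2 : Continuous fun s : ℝ => b (s • (x, y)) z :=
      (hb.continuous.comp hl1).clm_apply continuous_const
    have c3 : Continuous fun s : ℝ => T (s • k) z z :=
      ((hTs.continuous.comp hl).clm_apply continuous_const).clm_apply continuous_const
    have c4 : ∀ i, Continuous fun s : ℝ => R (s • (x, y)) i := fun i =>
      (continuous_apply i).comp (hR.continuous.comp hl1)
    have hc : Continuous fun s : ℝ => x * a (s • (x, y)) z + y * b (s • (x, y)) z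
        + T (s • k) z z + s ^ 2 * binaryQuartic a₀ a₁ a₂ a₃ a₄ x y
        + s ^ 4 * ∑ i : Fin 7, x ^ (6 - i : ℕ) * y ^ (i : ℕ) * R (s • (x, y)) i :=
      ((((continuous_const.mul c1).add (continuous_const.mul c2)).add c3).add
        ((continuous_pow 2).mul continuous_const)).add ((continuous_pow 4).mul
        (continuous_finsetSum _ fun i _ => continuous_const.mul (c4 i)))
    have := eq_of_tendsto_div_pow (h2 k) hc.continuousAt (fun s => by
        rw [hexp (s • k)]
        have e1 : (s • k).1 = s • (x, y) := rfl
        have e2 : (s • k).2 = s • z := rfl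
        rw [e1, e2, hFR (s • (x, y))]
        simp [Fin.sum_univ_succ, binaryQuartic]
        ring)
    simpa using this
  have hT0 : ∀ z, T 0 z z = B z z := fun z => by simpa using (hquad 0 0 z).symm
  have ha0 : a 0 = 0 := by
    ext z
    have := hquad 1 0 z
    rw [hT0] at this
    simpa using this
  have hb0 : b 0 = 0 := by
    ext z
    have := hquad 0 1 z
    rw [hT0] at this
    simpa using this
  obtain ⟨α₁, α₂, α₃, ⟨h1, h2, h3⟩, ⟨h1e, h2e, h3e⟩, ha'⟩ := exists_hadamard_even ha hae
  obtain ⟨β₁, β₂, β₃, ⟨k1, k2, k3⟩, ⟨k1e, k2e, k3e⟩, hb'⟩ := exists_hadamard_even hb hbe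
  refine ⟨R, ![α₁, fun u => α₂ u + β₁ u, fun u => α₃ u + β₂ u, β₃], fun k => T k - T 0,
    ⟨hR, fun i => ?_, hTs.sub contDiff_const⟩, ⟨hRe, fun i u => ?_, fun k => by simp [hTe]⟩,
    sub_self (T 0), fun k => ?_⟩
  · fin_cases i
    exacts [h1, h2.add k1, h3.add k2, k3]
  · fin_cases i <;> simp [h1e, h2e, h3e, k1e, k2e, k3e]
  · rw [hexp k, hFR k.1, ha' k.1, hb' k.1, ha0, hb0, ← hT0]
    simp [Fin.sum_univ_succ]
    ring

end Splitting

/-! ### Reduction of the quadratic part -/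

section Quadratic

variable {V Z : Type} [NormedAddCommGroup V] [NormedSpace ℝ V] [CompleteSpace V]
  [NormedAddCommGroup Z] [NormedSpace ℝ Z] [FiniteDimensional ℝ Z]

/-- A smooth even family of quadratic forms near a nondegenerate form `B` is, up to a smooth even
family of linear substitutions `1 + τ`, equal to `B`. -/
lemma exists_morse_family (B : Z ≃L[ℝ] (Z →L[ℝ] ℝ)) {T : V → Z →L[ℝ] Z →L[ℝ] ℝ}
    (hT : ContDiff ℝ ∞ T) (hTe : ∀ k, T (-k) = T k) (hT0 : T 0 = 0) :
    ∃ τ : V → Z →L[ℝ] Z, τ 0 = 0 ∧ SmoothNearZero τ ∧ (∀ᶠ k in 𝓝 0, τ (-k) = τ k) ∧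
      ∀ᶠ k in 𝓝 0, ∀ z, 2 * B (τ k z) z + B (τ k z) (τ k z) = T k z z := by
  have : CompleteSpace Z := FiniteDimensional.complete ℝ Z
  set Bl : Z →L[ℝ] Z →L[ℝ] ℝ := B.toContinuousLinearMap with hBl
  -- the equation is solved for bilinear forms, so that `T` need not be symmetric; it is linear to
  -- first order in `τ`, with linear part composition with `B`
  set C : (Z →L[ℝ] Z) →L[ℝ] (Z →L[ℝ] ℝ) →L[ℝ] (Z →L[ℝ] ℝ) :=
    (ContinuousLinearMap.compL ℝ Z Z ℝ).flip with hC
  have hCs : ContDiff ℝ ∞ C := by fun_prop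
  obtain ⟨τ, hτ0, hτs, hτe, hτ⟩ := exists_even_implicit
    (fun (k : V) (τ : Z →L[ℝ] Z) =>
      Bl ∘L τ + (1 / 2 : ℝ) • (C τ ∘L (Bl ∘L τ)) - (1 / 2 : ℝ) • T k) 0
    (ContinuousLinearEquiv.arrowCongr (ContinuousLinearEquiv.refl ℝ Z) B)
    (by
      refine Eventually.of_forall fun v => ContDiff.contDiffAt ?_
      have h1 : ContDiff ℝ ∞ fun w : V × (Z →L[ℝ] Z) => Bl ∘L w.2 :=
        contDiff_const.clm_comp contDiff_snd
      have h2 : ContDiff ℝ ∞ fun w : V × (Z →L[ℝ] Z) => C w.2 :=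
        hCs.comp contDiff_snd
      exact (h1.add ((h2.clm_comp h1).const_smul _)).sub
        ((hT.comp contDiff_fst).const_smul _))
    (by
      have h1 : HasFDerivAt (fun τ : Z →L[ℝ] Z => Bl ∘L τ)
          (ContinuousLinearMap.compL ℝ Z Z (Z →L[ℝ] ℝ) Bl) 0 :=
        (ContinuousLinearMap.compL ℝ Z Z (Z →L[ℝ] ℝ) Bl).hasFDerivAt
      have h3 := ((h1.add (((C.hasFDerivAt (x := (0 : Z →L[ℝ] Z))).clm_comp h1).const_smul
        (1 / 2 : ℝ))).sub_const ((1 / 2 : ℝ) • T 0))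
      refine h3.congr_fderiv ?_
      ext τ z z'
      simp [hBl])
    (by rw [hT0]; ext z z'; simp)
    (Eventually.of_forall fun k τ => by simp only [hTe])
  refine ⟨τ, hτ0, hτs, hτe, ?_⟩
  filter_upwards [hτ] with k hk z
  have := congrArg (fun L : Z →L[ℝ] Z →L[ℝ] ℝ => L z z) hk
  simp [hBl, hC] at this
  linarith

/-- Removal of the terms linear in `z`. -/
lemma exists_linear_family (B : Z ≃L[ℝ] (Z →L[ℝ] ℝ)) {S : V → Z →L[ℝ] ℝ}
    (hS : ContDiff ℝ ∞ S) (hSe : ∀ k, S (-k) = S k) {τ : V → Z →L[ℝ] Z} (hτ0 : τ 0 = 0)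
    (hτs : SmoothNearZero τ) (hτe : ∀ᶠ k in 𝓝 0, τ (-k) = τ k) :
    ∃ σ : V → Z, SmoothNearZero σ ∧ (∀ᶠ k in 𝓝 0, σ (-k) = σ k) ∧
      ∀ᶠ k in 𝓝 0, ∀ z, 2 * B (σ k) (z + τ k z) = S k z := by
  have : CompleteSpace Z := FiniteDimensional.complete ℝ Z
  set Bl : Z →L[ℝ] Z →L[ℝ] ℝ := B.toContinuousLinearMap with hBl
  obtain ⟨σ, -, hσs, hσe, hσ⟩ := exists_even_implicit
    (fun (k : V) (σ : Z) => Bl σ ∘L (ContinuousLinearMap.id ℝ Z + τ k) - (1 / 2 : ℝ) • S k)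
    (B.symm ((1 / 2 : ℝ) • S 0)) B
    (by
      have h1 : Tendsto (Prod.fst : V × Z → V) (𝓝 (0, B.symm ((1 / 2 : ℝ) • S 0))) (𝓝 0) :=
        continuous_fst.tendsto _
      filter_upwards [h1.eventually hτs] with v hv
      exact ((Bl.contDiff.comp contDiff_snd).contDiffAt.clm_comp
        (contDiffAt_const.add (hv.comp v contDiffAt_fst))).sub
        ((hS.comp contDiff_fst).contDiffAt.const_smul _))
    (by
      have h1 : HasFDerivAt (fun σ : Z => Bl σ - (1 / 2 : ℝ) • S 0) Bl
        (B.symm ((1 / 2 : ℝ) • S 0)) := Bl.hasFDerivAt.sub_const _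
      simpa [hτ0] using h1)
    (by
      rw [hτ0, add_zero, ContinuousLinearMap.comp_id, hBl]
      simp)
    (by filter_upwards [hτe] with k hk σ; rw [hk, hSe])
  refine ⟨σ, hσs, hσe, ?_⟩
  filter_upwards [hσ] with k hk z
  have := congrArg (fun L : Z →L[ℝ] ℝ => L z) hk
  simp [hBl] at this
  simp
  linarith

end Quadratic

/-! ### Reduction of the remainder of order six -/

/-- Coefficients of the product of two binary cubic forms given by their coefficients. -/
def cubicMul (f g : Fin 4 → ℝ) : Fin 7 → ℝ :=
  ![f 0 * g 0, f 0 * g 1 + f 1 * g 0, f 0 * g 2 + f 1 * g 1 + f 2 * g 0,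
    f 0 * g 3 + f 1 * g 2 + f 2 * g 1 + f 3 * g 0, f 1 * g 3 + f 2 * g 2 + f 3 * g 1,
    f 2 * g 3 + f 3 * g 2, f 3 * g 3]

/-- The binary cubic form with coefficients `f`. -/
def cubicEval (f : Fin 4 → ℝ) (x y : ℝ) : ℝ :=
  f 0 * x ^ 3 + f 1 * x ^ 2 * y + f 2 * x * y ^ 2 + f 3 * y ^ 3

/-- The binary sextic form with coefficients `f`. -/
def sexticEval (f : Fin 7 → ℝ) (x y : ℝ) : ℝ :=
  ∑ i : Fin 7, x ^ (6 - i : ℕ) * y ^ (i : ℕ) * f i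

lemma sexticEval_cubicMul (f g : Fin 4 → ℝ) (x y : ℝ) :
    sexticEval (cubicMul f g) x y = cubicEval f x y * cubicEval g x y := by
  simp [sexticEval, cubicMul, cubicEval, Fin.sum_univ_succ]
  ring

lemma sexticEval_add (f g : Fin 7 → ℝ) (x y : ℝ) :
    sexticEval (f + g) x y = sexticEval f x y + sexticEval g x y := by
  simp [sexticEval, mul_add, Finset.sum_add_distrib]

lemma sexticEval_smul (c : ℝ) (f : Fin 7 → ℝ) (x y : ℝ) :
    sexticEval (c • f) x y = c * sexticEval f x y := by
  simp only [sexticEval, Finset.mul_sum, Pi.smul_apply, smul_eq_mul]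
  exact Finset.sum_congr rfl fun i _ => by ring

/-- The first component of the cubic vector field with parameters `w`. -/
def fieldX (w : Fin 7 → ℝ) : Fin 4 → ℝ := ![w 0, w 4, w 1, w 6]

/-- The second component of the cubic vector field with parameters `w`. The monomial `x³` is left
out: the eight cubic fields yield only seven sextic forms. -/
def fieldY (w : Fin 7 → ℝ) : Fin 4 → ℝ := ![0, w 2, w 5, w 3]

/-- The derivative of `e x⁴ + a x² y² + e' y⁴` along the cubic vector field with parameters `w`,
as a linear map from parameters to coefficients of sextic forms. -/
def sexticMap (e e' a : ℝ) : (Fin 7 → ℝ) →ₗ[ℝ] (Fin 7 → ℝ) where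
  toFun w := ![4 * e * w 0, 4 * e * w 4, 2 * a * w 0 + 4 * e * w 1 + 2 * a * w 2,
    2 * a * w 4 + 4 * e * w 6 + 2 * a * w 5, 2 * a * w 1 + 4 * e' * w 2 + 2 * a * w 3,
    4 * e' * w 5 + 2 * a * w 6, 4 * e' * w 3]
  map_add' v w := by
    ext i
    fin_cases i <;> simp <;> ring
  map_smul' c w := by
    ext i
    fin_cases i <;> simp <;> ring

lemma sexticEval_sexticMap (e e' a : ℝ) (w : Fin 7 → ℝ) (x y : ℝ) :
    sexticEval (sexticMap e e' a w) x y =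
      (4 * e * x ^ 3 + 2 * a * x * y ^ 2) * cubicEval (fieldX w) x y
        + (2 * a * x ^ 2 * y + 4 * e' * y ^ 3) * cubicEval (fieldY w) x y := by
  simp [sexticEval, sexticMap, cubicEval, fieldX, fieldY, Fin.sum_univ_succ]
  ring

/-- For a normal form with nonzero discriminant, every sextic form lies in the ideal generated by
the partial derivatives. -/
lemma sexticMap_injective {e e' a : ℝ} (he : e ≠ 0) (he' : e' ≠ 0) (ha : a ^ 2 ≠ 4 * (e * e')) :
    Function.Injective (sexticMap e e' a) := by
  rw [← LinearMap.ker_eq_bot, LinearMap.ker_eq_bot']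
  intro w hw
  have h := fun i => congrFun hw i
  have h0 : 4 * e * w 0 = 0 := h 0
  have h1 : 4 * e * w 4 = 0 := h 1
  have h2 : 2 * a * w 0 + 4 * e * w 1 + 2 * a * w 2 = 0 := h 2
  have h3 : 2 * a * w 4 + 4 * e * w 6 + 2 * a * w 5 = 0 := h 3
  have h4 : 2 * a * w 1 + 4 * e' * w 2 + 2 * a * w 3 = 0 := h 4
  have h5 : 4 * e' * w 5 + 2 * a * w 6 = 0 := h 5
  have h6 : 4 * e' * w 3 = 0 := h 6
  have w0 : w 0 = 0 := by simpa [he] using h0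
  have w4 : w 4 = 0 := by simpa [he] using h1
  have w3 : w 3 = 0 := by simpa [he'] using h6
  rw [w0] at h2
  rw [w3] at h4
  rw [w4] at h3
  have hd : a ^ 2 - 4 * (e * e') ≠ 0 := sub_ne_zero.mpr ha
  have w1 : w 1 = 0 := by
    refine (mul_eq_zero.mp (?_ : (a ^ 2 - 4 * (e * e')) * w 1 = 0)).resolve_left hd
    linear_combination (a / 2) * h4 - e' * h2
  have w2 : w 2 = 0 := by
    refine (mul_eq_zero.mp (?_ : (a ^ 2 - 4 * (e * e')) * w 2 = 0)).resolve_left hd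
    linear_combination (a / 2) * h2 - e * h4
  have w5 : w 5 = 0 := by
    refine (mul_eq_zero.mp (?_ : (a ^ 2 - 4 * (e * e')) * w 5 = 0)).resolve_left hd
    linear_combination (a / 2) * h3 - e * h5
  have w6 : w 6 = 0 := by
    refine (mul_eq_zero.mp (?_ : (a ^ 2 - 4 * (e * e')) * w 6 = 0)).resolve_left hd
    linear_combination (a / 2) * h5 - e' * h3
  ext i
  fin_cases i <;> assumption

lemma contDiff_cubicMul {V : Type*} [NormedAddCommGroup V] [NormedSpace ℝ V]
    {f g : V → Fin 4 → ℝ} (hf : ContDiff ℝ ∞ f) (hg : ContDiff ℝ ∞ g) :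
    ContDiff ℝ ∞ fun v => cubicMul (f v) (g v) := by
  rw [contDiff_pi] at hf hg
  have := fun i j => (hf i).mul (hg j)
  rw [contDiff_pi]
  intro i
  fin_cases i
  exacts [this 0 0, (this 0 1).add (this 1 0), ((this 0 2).add (this 1 1)).add (this 2 0),
    (((this 0 3).add (this 1 2)).add (this 2 1)).add (this 3 0),
    ((this 1 3).add (this 2 2)).add (this 3 1), (this 2 3).add (this 3 2), this 3 3]

lemma contDiff_cubicEval {V : Type*} [NormedAddCommGroup V] [NormedSpace ℝ V]
    {f : V → Fin 4 → ℝ} {x y : V → ℝ} (hf : ContDiff ℝ ∞ f) (hx : ContDiff ℝ ∞ x)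
    (hy : ContDiff ℝ ∞ y) : ContDiff ℝ ∞ fun v => cubicEval (f v) (x v) (y v) := by
  rw [contDiff_pi] at hf
  have h0 := hf 0
  have h1 := hf 1
  have h2 := hf 2
  have h3 := hf 3
  simp only [cubicEval]
  fun_prop

lemma contDiff_fieldX : ContDiff ℝ ∞ fieldX := by
  rw [contDiff_pi]
  intro i
  fin_cases i <;> simp [fieldX] <;> fun_prop

lemma contDiff_fieldY : ContDiff ℝ ∞ fieldY := by
  rw [contDiff_pi]
  intro i
  fin_cases i <;> simp [fieldY] <;> fun_prop

lemma cubicEval_neg (f : Fin 4 → ℝ) (x y : ℝ) : cubicEval f (-x) (-y) = -cubicEval f x y := by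
  simp only [cubicEval]
  ring

/-- A smooth even perturbation by sextic terms of a normal form with nonzero discriminant is
absorbed by a displacement along cubic vector fields with smooth even coefficients. -/
lemma exists_sextic_absorption {V : Type} [NormedAddCommGroup V] [NormedSpace ℝ V]
    [CompleteSpace V] (X Y : V →L[ℝ] ℝ) {ε η : ℤˣ} {a : ℝ} (ha : ε = η → a ^ 2 ≠ 4)
    {R : V → Fin 7 → ℝ} (hR : SmoothNearZero R) (hRe : ∀ᶠ k in 𝓝 0, R (-k) = R k) :
    ∃ w : V → Fin 7 → ℝ, SmoothNearZero w ∧ (∀ᶠ k in 𝓝 0, w (-k) = w k) ∧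
      ∀ᶠ k in 𝓝 0, normalQuartic ε η a (X k + cubicEval (fieldX (w k)) (X k) (Y k))
        (Y k + cubicEval (fieldY (w k)) (X k) (Y k)) =
        normalQuartic ε η a (X k) (Y k) + sexticEval (R k) (X k) (Y k) := by
  set e : ℝ := ((ε : ℤ) : ℝ) with he
  set e' : ℝ := ((η : ℤ) : ℝ) with he'
  have he2 : e ^ 2 = 1 := sq_intCast_units ε
  have he2' : e' ^ 2 = 1 := sq_intCast_units η
  have he0 : e ≠ 0 := by rintro h; simp [h] at he2
  have he0' : e' ≠ 0 := by rintro h; simp [h] at he2'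
  have hdisc : a ^ 2 ≠ 4 * (e * e') := by
    intro h
    have h1 := quarticDiscriminant_normal_ne_zero ha
    rw [quarticDiscriminant_normal] at h1
    apply h1
    push_cast
    rw [← he, ← he', h, sub_self]
    ring
  set L : (Fin 7 → ℝ) ≃L[ℝ] (Fin 7 → ℝ) := (LinearEquiv.ofInjectiveEndo (sexticMap e e' a)
    (sexticMap_injective he0 he0' hdisc)).toContinuousLinearEquiv with hL
  have hLw : ∀ w, L w = sexticMap e e' a w := fun w => rfl
  -- the terms of `N (x + P, y + Q)` of order at least two in `(P, Q)`, divided by `P²`, `P Q`, `Q²`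
  set P : V → (Fin 7 → ℝ) → ℝ := fun k w => cubicEval (fieldX w) (X k) (Y k) with hP
  set Q : V → (Fin 7 → ℝ) → ℝ := fun k w => cubicEval (fieldY w) (X k) (Y k) with hQ
  set g₁ : V → (Fin 7 → ℝ) → ℝ := fun k w =>
    e * (6 * X k ^ 2 + 4 * X k * P k w + P k w ^ 2) + a * (Y k + Q k w) ^ 2 with hg₁
  set g₂ : V → (Fin 7 → ℝ) → ℝ := fun k _ => a * (4 * X k * Y k) with hg₂
  set g₃ : V → (Fin 7 → ℝ) → ℝ := fun k w =>
    a * (X k ^ 2 + 2 * X k * P k w) + e' * (6 * Y k ^ 2 + 4 * Y k * Q k w + Q k w ^ 2) with hg₃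
  set M : V → (Fin 7 → ℝ) → Fin 7 → ℝ := fun k w =>
    g₁ k w • cubicMul (fieldX w) (fieldX w) + g₂ k w • cubicMul (fieldX w) (fieldY w)
      + g₃ k w • cubicMul (fieldY w) (fieldY w) with hM
  have hP0 : ∀ w, P 0 w = 0 := fun w => by simp [hP, cubicEval]
  have hQ0 : ∀ w, Q 0 w = 0 := fun w => by simp [hQ, cubicEval]
  have hM0 : ∀ w, M 0 w = 0 := fun w => by simp [hM, hg₁, hg₂, hg₃, hP0, hQ0]
  have hPe : ∀ k w, P (-k) w = -P k w := fun k w => by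
    simp only [hP, map_neg, cubicEval_neg]
  have hQe : ∀ k w, Q (-k) w = -Q k w := fun k w => by
    simp only [hQ, map_neg, cubicEval_neg]
  have hMe : ∀ k w, M (-k) w = M k w := fun k w => by
    have e1 : g₁ (-k) w = g₁ k w := by simp only [hg₁, map_neg, hPe, hQe]; ring
    have e2 : g₂ (-k) w = g₂ k w := by simp only [hg₂, map_neg]; ring
    have e3 : g₃ (-k) w = g₃ k w := by simp only [hg₃, map_neg, hPe, hQe]; ring
    simp only [hM, e1, e2, e3]
  have hMs : ContDiff ℝ ∞ fun v : V × (Fin 7 → ℝ) => M v.1 v.2 := by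
    have sX : ContDiff ℝ ∞ fun v : V × (Fin 7 → ℝ) => X v.1 := X.contDiff.comp contDiff_fst
    have sY : ContDiff ℝ ∞ fun v : V × (Fin 7 → ℝ) => Y v.1 := Y.contDiff.comp contDiff_fst
    have fX : ContDiff ℝ ∞ fun v : V × (Fin 7 → ℝ) => fieldX v.2 :=
      contDiff_fieldX.comp contDiff_snd
    have fY : ContDiff ℝ ∞ fun v : V × (Fin 7 → ℝ) => fieldY v.2 :=
      contDiff_fieldY.comp contDiff_snd
    have sP : ContDiff ℝ ∞ fun v : V × (Fin 7 → ℝ) => P v.1 v.2 := contDiff_cubicEval fX sX sY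
    have sQ : ContDiff ℝ ∞ fun v : V × (Fin 7 → ℝ) => Q v.1 v.2 := contDiff_cubicEval fY sX sY
    have s1 : ContDiff ℝ ∞ fun v : V × (Fin 7 → ℝ) => g₁ v.1 v.2 := by
      simp only [hg₁]
      fun_prop
    have s2 : ContDiff ℝ ∞ fun v : V × (Fin 7 → ℝ) => g₂ v.1 v.2 := by
      simp only [hg₂]
      fun_prop
    have s3 : ContDiff ℝ ∞ fun v : V × (Fin 7 → ℝ) => g₃ v.1 v.2 := by
      simp only [hg₃]
      fun_prop
    exact ((s1.smul (contDiff_cubicMul fX fX)).add (s2.smul (contDiff_cubicMul fX fY))).add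
      (s3.smul (contDiff_cubicMul fY fY))
  -- the nonlinear terms `M` vanish at `k = 0`, so the derivative in `w` there is `L`
  obtain ⟨w, -, hws, hwe, hw⟩ := exists_even_implicit (fun k w => L w + M k w - R k)
    (L.symm (R 0)) L
    (by
      have h1 : Tendsto (Prod.fst : V × (Fin 7 → ℝ) → V) (𝓝 (0, L.symm (R 0))) (𝓝 0) :=
        continuous_fst.tendsto _
      filter_upwards [h1.eventually hR] with v hv
      exact ((L.contDiff.comp contDiff_snd).add hMs).contDiffAt.sub (hv.comp v contDiffAt_fst))
    (by
      simp only [hM0, add_zero]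
      exact L.hasFDerivAt.sub_const _)
    (by simp [hM0])
    (by filter_upwards [hRe] with k hk w; rw [hMe, hk])
  refine ⟨w, hws, hwe, ?_⟩
  filter_upwards [hw] with k hk
  have hsum : L (w k) + M k (w k) = R k := sub_eq_zero.mp hk
  rw [← hsum, sexticEval_add, hLw, sexticEval_sexticMap]
  simp only [hM, sexticEval_add, sexticEval_smul, sexticEval_cubicMul]
  simp only [hg₁, hg₂, hg₃, hP, hQ, normalQuartic, binaryQuartic]
  generalize cubicEval (fieldX (w k)) (X k) (Y k) = p
  generalize cubicEval (fieldY (w k)) (X k) (Y k) = q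
  ring

/-! ### Determinacy of the normal form -/

section Determinacy

variable {V F : Type} [NormedAddCommGroup V] [NormedSpace ℝ V]
  [NormedAddCommGroup F] [NormedSpace ℝ F]

/-- A combination of the cubic monomials in `X`, `Y` with smooth even coefficients is smooth and
odd near `0`, and its derivative at `0` vanishes. -/
lemma cubic_combination (X Y : V →L[ℝ] ℝ) {c : Fin 4 → V → F} (hc : ∀ i, SmoothNearZero (c i))
    (hce : ∀ i, ∀ᶠ k in 𝓝 0, c i (-k) = c i k) :
    SmoothNearZero (fun k => ∑ i : Fin 4, (X k ^ (3 - i : ℕ) * Y k ^ (i : ℕ)) • c i k) ∧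
    (∀ᶠ k in 𝓝 0, ∑ i : Fin 4, (X (-k) ^ (3 - i : ℕ) * Y (-k) ^ (i : ℕ)) • c i (-k) =
      -∑ i : Fin 4, (X k ^ (3 - i : ℕ) * Y k ^ (i : ℕ)) • c i k) ∧
    HasFDerivAt (fun k => ∑ i : Fin 4, (X k ^ (3 - i : ℕ) * Y k ^ (i : ℕ)) • c i k)
      (0 : V →L[ℝ] F) 0 := by
  refine ⟨?_, ?_, ?_⟩
  · filter_upwards [eventually_all.mpr hc] with k hk
    exact ContDiffAt.sum fun i _ =>
      (((X.contDiff.pow _).mul (Y.contDiff.pow _)).contDiffAt).smul (hk i)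
  · filter_upwards [eventually_all.mpr hce] with k hk
    rw [← Finset.sum_neg_distrib]
    refine Finset.sum_congr rfl fun i _ => ?_
    rw [hk, ← neg_smul]
    congr 1
    simp only [map_neg]
    fin_cases i <;> simp <;> ring
  · have hmul : ∀ {f g : V → ℝ}, DifferentiableAt ℝ f 0 → DifferentiableAt ℝ g 0 → f 0 = 0 →
        g 0 = 0 → HasFDerivAt (fun k => f k * g k) (0 : V →L[ℝ] ℝ) 0 := by
      intro f g hf hg hf0 hg0
      refine (hf.hasFDerivAt.mul hg.hasFDerivAt).congr_fderiv ?_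
      rw [hf0, hg0]
      simp
    have hmon : ∀ i : Fin 4, HasFDerivAt (fun k => X k ^ (3 - i : ℕ) * Y k ^ (i : ℕ))
        (0 : V →L[ℝ] ℝ) 0 := by
      intro i
      fin_cases i
      · have := hmul (f := X) (g := fun k => X k ^ 2) (by fun_prop) (by fun_prop) (by simp)
          (by simp)
        refine this.congr_of_eventuallyEq (Eventually.of_forall fun k => ?_)
        simp; ring
      · have := hmul (f := X) (g := fun k => X k * Y k) (by fun_prop) (by fun_prop) (by simp)
          (by simp)
        refine this.congr_of_eventuallyEq (Eventually.of_forall fun k => ?_)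
        simp; ring
      · have := hmul (f := X) (g := fun k => Y k ^ 2) (by fun_prop) (by fun_prop) (by simp)
          (by simp)
        refine this.congr_of_eventuallyEq (Eventually.of_forall fun k => ?_)
        simp
      · have := hmul (f := Y) (g := fun k => Y k ^ 2) (by fun_prop) (by fun_prop) (by simp)
          (by simp)
        refine this.congr_of_eventuallyEq (Eventually.of_forall fun k => ?_)
        simp; ring
    have hterm : ∀ i : Fin 4, HasFDerivAt
        (fun k => (X k ^ (3 - i : ℕ) * Y k ^ (i : ℕ)) • c i k) (0 : V →L[ℝ] F) 0 := by
      intro i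
      have hci := ((hc i).self_of_nhds.differentiableAt (by simp)).hasFDerivAt
      refine ((hmon i).smul hci).congr_fderiv ?_
      ext v
      fin_cases i <;> simp
    refine (HasFDerivAt.fun_sum fun i (_ : i ∈ Finset.univ) => hterm i).congr_fderiv ?_
    simp

lemma cubicEval_eq_sum (f : Fin 4 → ℝ) (x y : ℝ) :
    cubicEval f x y = ∑ i : Fin 4, (x ^ (3 - i : ℕ) * y ^ (i : ℕ)) • f i := by
  simp [cubicEval, Fin.sum_univ_succ]
  ring

variable {Z : Type} [NormedAddCommGroup Z] [NormedSpace ℝ Z]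

/-- Coefficients of the sextic form obtained by evaluating a symmetric bilinear form on a
vector-valued cubic form. -/
def bilinCubic (B : Z → Z → ℝ) (σ : Fin 4 → Z) : Fin 7 → ℝ :=
  ![B (σ 0) (σ 0), 2 * B (σ 0) (σ 1), 2 * B (σ 0) (σ 2) + B (σ 1) (σ 1),
    2 * B (σ 0) (σ 3) + 2 * B (σ 1) (σ 2), 2 * B (σ 1) (σ 3) + B (σ 2) (σ 2),
    2 * B (σ 2) (σ 3), B (σ 3) (σ 3)]

lemma sexticEval_bilinCubic (B : Z →L[ℝ] Z →L[ℝ] ℝ) (hB : ∀ z z', B z z' = B z' z)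
    (σ : Fin 4 → Z) (x y : ℝ) :
    sexticEval (bilinCubic (fun z z' => B z z') σ) x y =
      B (∑ i : Fin 4, (x ^ (3 - i : ℕ) * y ^ (i : ℕ)) • σ i)
        (∑ i : Fin 4, (x ^ (3 - i : ℕ) * y ^ (i : ℕ)) • σ i) := by
  simp [sexticEval, bilinCubic, Fin.sum_univ_succ]
  rw [hB (σ 1) (σ 0), hB (σ 2) (σ 0), hB (σ 3) (σ 0), hB (σ 2) (σ 1), hB (σ 3) (σ 1),
    hB (σ 3) (σ 2)]
  ring

/-- An even smooth function whose quadratic part is a nondegenerate form in `z` and whose quartic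
part on the plane `z = 0` is a normal form with nonzero discriminant is equivalent to the sum of
these leading parts under an odd change of variables. -/
lemma exists_oddDiffeo_normalForm [FiniteDimensional ℝ Z] {f : (ℝ × ℝ) × Z → ℝ}
    (hf : ContDiff ℝ ∞ f) (heven : ∀ k, f (-k) = f k) (B : Z ≃L[ℝ] (Z →L[ℝ] ℝ)) (hB : ∀ z z', B z z' = B z' z)
    (h2 : ∀ k : (ℝ × ℝ) × Z, Tendsto (fun s : ℝ => (f (s • k) - f 0) / s ^ 2) (𝓝[≠] 0)
      (𝓝 (B k.2 k.2)))
    {ε η : ℤˣ} {a : ℝ} (ha : ε = η → a ^ 2 ≠ 4)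
    (h4 : ∀ u : ℝ × ℝ, Tendsto (fun s : ℝ => (f (s • (u, 0)) - f 0) / s ^ 4) (𝓝[≠] 0)
      (𝓝 (normalQuartic ε η a u.1 u.2))) :
    ∃ h : (ℝ × ℝ) × Z → (ℝ × ℝ) × Z, IsOddDiffeoGerm h ∧
      ∀ᶠ k in 𝓝 0, f k = f 0 + normalQuartic ε η a (h k).1.1 (h k).1.2 + B (h k).2 (h k).2 := by
  have : CompleteSpace Z := FiniteDimensional.complete ℝ Z
  set Bl : Z →L[ℝ] Z →L[ℝ] ℝ := B.toContinuousLinearMap with hBl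
  have hBl' : ∀ z z', Bl z z' = B z z' := fun z z' => rfl
  set X : (ℝ × ℝ) × Z →L[ℝ] ℝ := .fst ℝ ℝ ℝ ∘L .fst ℝ (ℝ × ℝ) Z with hX
  set Y : (ℝ × ℝ) × Z →L[ℝ] ℝ := .snd ℝ ℝ ℝ ∘L .fst ℝ (ℝ × ℝ) Z with hY
  have hXk : ∀ k, X k = k.1.1 := fun k => rfl
  have hYk : ∀ k, Y k = k.1.2 := fun k => rfl
  obtain ⟨R, S, T, ⟨hR, hS, hT⟩, ⟨hRe, hSe, hTe⟩, hT0, hexp⟩ :=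
    exists_even_expansion hf heven Bl h2 h4
  obtain ⟨τ, hτ0, hτs, hτe, hτ⟩ := exists_morse_family B hT hTe hT0
  choose σ hσs hσe hσ using fun i => exists_linear_family B
    (S := fun k : (ℝ × ℝ) × Z => S i k.1) ((hS i).comp contDiff_fst)
    (fun k => hSe i k.1) hτ0 hτs hτe
  -- the square of the displacement in `z` contributes to the sextic terms
  have hBc : ∀ i j, SmoothNearZero fun k => Bl (σ i k) (σ j k) := by
    intro i j
    filter_upwards [hσs i, hσs j] with k hi hj
    exact (Bl.contDiff.contDiffAt.comp k hi).clm_apply hj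
  obtain ⟨w, hws, hwe, hw⟩ := exists_sextic_absorption X Y ha
    (R := fun k => R k.1 - bilinCubic (fun z z' => Bl z z') (fun i => σ i k))
    (by
      filter_upwards [eventually_all.mpr fun i => eventually_all.mpr (hBc i)] with k hk
      refine (hR.comp contDiff_fst).contDiffAt.sub ?_
      rw [contDiffAt_pi]
      intro i
      have h2k := fun i j => (contDiffAt_const (c := (2 : ℝ))).mul (hk i j)
      fin_cases i
      exacts [hk 0 0, h2k 0 1, (h2k 0 2).add (hk 1 1), (h2k 0 3).add (h2k 1 2),
        (h2k 1 3).add (hk 2 2), h2k 2 3, hk 3 3])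
    (by
      filter_upwards [eventually_all.mpr hσe] with k hk
      simp only [hk, Prod.fst_neg, hRe])
  obtain ⟨ps, po, pd⟩ := cubic_combination X Y (c := fun i k => fieldX (w k) i)
    (fun i => by
      filter_upwards [hws] with k hk
      exact contDiffAt_pi.mp (contDiff_fieldX.contDiffAt.comp k hk) i)
    (fun i => by filter_upwards [hwe] with k hk; rw [hk])
  obtain ⟨qs, qo, qd⟩ := cubic_combination X Y (c := fun i k => fieldY (w k) i)
    (fun i => by
      filter_upwards [hws] with k hk
      exact contDiffAt_pi.mp (contDiff_fieldY.contDiffAt.comp k hk) i)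
    (fun i => by filter_upwards [hwe] with k hk; rw [hk])
  obtain ⟨ss, so, sd⟩ := cubic_combination X Y hσs hσe
  simp only [← cubicEval_eq_sum] at ps po pd qs qo qd
  set p := fun k => cubicEval (fieldX (w k)) (X k) (Y k) with hp
  set q := fun k => cubicEval (fieldY (w k)) (X k) (Y k) with hq
  set s := fun k => ∑ i : Fin 4, (X k ^ (3 - i : ℕ) * Y k ^ (i : ℕ)) • σ i k with hs
  refine ⟨fun k => k + ((p k, q k), τ k k.2 + s k), IsOddDiffeoGerm.of_hasFDerivAt_id ?_ ?_ ?_ ?_,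
    ?_⟩
  · simp [hp, hq, hs, cubicEval, Fin.sum_univ_succ, Prod.ext_iff]
  · filter_upwards [po, qo, so, hτe] with k h1 h2 h3 h4
    have h1' : p (-k) = -p k := h1
    have h2' : q (-k) = -q k := h2
    have h3' : s (-k) = -s k := h3
    simp only [h1', h2', h3', h4, Prod.ext_iff]
    simp
    refine ⟨⟨by ring, by ring⟩, by abel⟩
  · filter_upwards [ps, qs, ss, hτs] with k h1 h2 h3 h4
    exact contDiffAt_id.add ((h1.prodMk h2).prodMk ((h4.clm_apply contDiffAt_snd).add h3))
  · have hτd : HasFDerivAt (fun k : (ℝ × ℝ) × Z => τ k k.2) (0 : (ℝ × ℝ) × Z →L[ℝ] Z) 0 := by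
      have h1 := (hτs.self_of_nhds.differentiableAt (by simp)).hasFDerivAt
      refine (h1.clm_apply (hasFDerivAt_snd (p := (0 : (ℝ × ℝ) × Z)))).congr_fderiv ?_
      ext v <;> simp [hτ0]
    refine ((hasFDerivAt_id _).add ((pd.prodMk qd).prodMk (hτd.add sd))).congr_fderiv ?_
    ext v <;> simp
  · filter_upwards [hw, hτ, eventually_all.mpr hσ] with k h1 h2 h3
    have hlin : 2 * Bl (s k) (k.2 + τ k k.2) =
        ∑ i : Fin 4, k.1.1 ^ (3 - i : ℕ) * k.1.2 ^ (i : ℕ) * S i k.1 k.2 := by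
      simp only [hs, map_sum, map_smul, sum_apply, Finset.mul_sum]
      refine Finset.sum_congr rfl fun i _ => ?_
      rw [← h3 i k.2]
      simp [hBl', hXk, hYk]
      ring
    have hsq : Bl (s k) (s k) = sexticEval (bilinCubic (fun z z' => Bl z z') fun i => σ i k)
        k.1.1 k.1.2 := (sexticEval_bilinCubic Bl hB _ _ _).symm
    have hsub : sexticEval (R k.1 - bilinCubic (fun z z' => Bl z z') fun i => σ i k) k.1.1 k.1.2
        = sexticEval (R k.1) k.1.1 k.1.2
          - sexticEval (bilinCubic (fun z z' => Bl z z') fun i => σ i k) k.1.1 k.1.2 := by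
      simp [sexticEval, mul_sub]
    have hz : Bl (k.2 + (τ k k.2 + s k)) (k.2 + (τ k k.2 + s k)) = Bl k.2 k.2
        + (2 * Bl (τ k k.2) k.2 + Bl (τ k k.2) (τ k k.2)) + 2 * Bl (s k) (k.2 + τ k k.2)
        + Bl (s k) (s k) := by
      have e1 := hB k.2 (τ k k.2)
      have e2 := hB k.2 (s k)
      have e3 := hB (τ k k.2) (s k)
      simp only [← hBl'] at e1 e2 e3
      simp only [map_add, add_apply]
      rw [e1, e2, e3]
      ring
    have h1' : normalQuartic ε η a (k.1.1 + p k) (k.1.2 + q k) = normalQuartic ε η a k.1.1 k.1.2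
        + sexticEval (R k.1 - bilinCubic (fun z z' => Bl z z') fun i => σ i k) k.1.1 k.1.2 := h1
    have h2' := h2 k.2
    simp only [← hBl'] at h2' ⊢
    have hsx : sexticEval (R k.1) k.1.1 k.1.2 =
        ∑ i : Fin 7, k.1.1 ^ (6 - i : ℕ) * k.1.2 ^ (i : ℕ) * R k.1 i := rfl
    have hN : binaryQuartic ((ε : ℤ) : ℝ) 0 a 0 ((η : ℤ) : ℝ) k.1.1 k.1.2 =
      normalQuartic ε η a k.1.1 k.1.2 := rfl
    simp only [Prod.fst_add, Prod.snd_add]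
    rw [hexp k, h1', hz, hlin, hsq, h2', hsub, hsx, hN]
    ring

end Determinacy

/-! ### Globalisation of germs and jets at the origin -/

section Jets

variable {E F : Type*} [NormedAddCommGroup E] [NormedSpace ℝ E]
  [NormedAddCommGroup F] [NormedSpace ℝ F]

/-- A smooth germ of parity `c = ±1` has a globally smooth representative of the same parity. -/
lemma exists_global_representative [FiniteDimensional ℝ E] {f : E → F}
    (hf : SmoothNearZero f) {c : ℝ} (hc : c * c = 1) (hpar : ∀ᶠ k in 𝓝 0, f (-k) = c • f k) :
    ∃ g : E → F, ContDiff ℝ ∞ g ∧ (∀ k, g (-k) = c • g k) ∧ g =ᶠ[𝓝 0] f := by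
  obtain ⟨r, hr, hball⟩ := Metric.eventually_nhds_iff_ball.mp hf
  let χ : ContDiffBump (0 : E) := ⟨r / 4, r / 2, by positivity, by linarith⟩
  have hg : ContDiff ℝ ∞ fun k => χ k • f k := by
    rw [contDiff_iff_contDiffAt]
    intro k
    by_cases hk : k ∈ Metric.ball (0 : E) r
    · exact χ.contDiffAt.smul (hball k hk)
    · have hk' : k ∉ tsupport χ := by
        rw [χ.tsupport_eq]
        intro h
        apply hk
        have h' : dist k 0 ≤ r / 2 := h
        exact Metric.mem_ball.mpr (by linarith)
      have hz : (fun k => χ k • f k) =ᶠ[𝓝 k] fun _ => 0 := by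
        filter_upwards [(isClosed_tsupport χ).isOpen_compl.mem_nhds hk'] with x hx
        rw [image_eq_zero_of_notMem_tsupport hx, zero_smul]
      exact contDiffAt_const.congr_of_eventuallyEq hz
  refine ⟨fun k => (1 / 2 : ℝ) • (χ k • f k + c • (χ (-k) • f (-k))), ?_, fun k => ?_, ?_⟩
  · exact (hg.add ((hg.comp contDiff_neg).const_smul c)).const_smul _
  · beta_reduce
    rw [neg_neg, smul_comm c (1 / 2 : ℝ), smul_add c, smul_smul c c, hc, one_smul, add_comm]
  · filter_upwards [χ.eventuallyEq_one, hpar] with k h1 h2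
    rw [χ.neg, h1, h2, smul_smul c, Pi.one_apply, one_smul, mul_one, smul_smul, hc, one_smul,
      ← two_smul ℝ (f k), smul_smul]
    norm_num

lemma iteratedDeriv_zero_of_parity {φ : ℝ → ℝ} {c : ℝ} (hpar : ∀ s, φ (-s) = c • φ s) {n : ℕ}
    (hφ : ContDiff ℝ ∞ φ) (hn : c * (-1) ^ n = -1) : iteratedDeriv n φ 0 = 0 := by
  have h1 := iteratedDeriv_comp_neg n φ 0
  have h2 : (fun s => φ (-s)) = fun s => c • φ s := funext hpar
  have hφn : ContDiff ℝ n φ := hφ.of_le (by exact_mod_cast le_top)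
  rw [h2, iteratedDeriv_fun_const_smul hφn.contDiffAt] at h1
  rw [neg_zero] at h1
  simp only [smul_eq_mul] at h1
  rcases neg_one_pow_eq_or ℝ n with h | h <;> rw [h] at h1 hn <;> nlinarith

/-- The limit form of Taylor's theorem when all Taylor coefficients of lower order vanish. -/
lemma tendsto_div_pow_of_iteratedDeriv_eq_zero {φ : ℝ → ℝ} (hφ : ContDiff ℝ ∞ φ) (n : ℕ)
    (h0 : ∀ j, 0 < j → j < n → iteratedDeriv j φ 0 = 0) (hn : 0 < n) :
    Tendsto (fun s => (φ s - φ 0) / s ^ n) (𝓝[≠] 0)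
      (𝓝 ((n.factorial : ℝ)⁻¹ * iteratedDeriv n φ 0)) := by
  have h := (taylor_isLittleO_univ (x₀ := 0) (n := n)
    (hφ.of_le (by exact_mod_cast le_top))).mono (nhdsWithin_le_nhds (s := {0}ᶜ))
  have hT : ∀ s, taylorWithinEval φ n Set.univ 0 s =
      φ 0 + (n.factorial : ℝ)⁻¹ * iteratedDeriv n φ 0 * s ^ n := by
    intro s
    obtain ⟨n, rfl⟩ := Nat.exists_eq_succ_of_ne_zero hn.ne'
    rw [taylor_within_apply, Finset.sum_range_succ, Finset.sum_range_succ', Finset.sum_eq_zero]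
    · simp
      ring
    · intro j hj
      rw [iteratedDerivWithin_univ, h0 (j + 1) (Nat.succ_pos j)
        (by have := Finset.mem_range.mp hj; omega), smul_zero]
  simp only [hT, sub_zero] at h
  have h' := h.tendsto_div_nhds_zero.add_const ((n.factorial : ℝ)⁻¹ * iteratedDeriv n φ 0)
  rw [zero_add] at h'
  refine h'.congr' ?_
  filter_upwards [self_mem_nhdsWithin] with s hs
  have : s ≠ 0 := hs
  field_simp
  ring

lemma iteratedDeriv_along_line {f : E → ℝ} (hf : ContDiff ℝ ∞ f) (k : E) (n : ℕ) :
    iteratedDeriv n (fun s : ℝ => f (s • k)) 0 = iteratedFDeriv ℝ n f 0 fun _ => k := by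
  have h := (ContinuousLinearMap.toSpanSingleton ℝ k).iteratedFDeriv_comp_right
    (hf.of_le (by exact_mod_cast le_top : (n : WithTop ℕ∞) ≤ ∞)) 0 le_rfl
  have h' : (fun s : ℝ => f (s • k)) = f ∘ ContinuousLinearMap.toSpanSingleton ℝ k := rfl
  rw [iteratedDeriv, h', h]
  simp

/-- The quadratic part of an even function as a limit. -/
lemma tendsto_quadratic_part {f : E → ℝ} (hf : ContDiff ℝ ∞ f) (heven : ∀ k, f (-k) = f k)
    (k : E) : Tendsto (fun s : ℝ => (f (s • k) - f 0) / s ^ 2) (𝓝[≠] 0)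
      (𝓝 (1 / 2 * secondDifferential f k k)) := by
  have hφ : ContDiff ℝ ∞ fun s : ℝ => f (s • k) := hf.comp (by fun_prop)
  have hpar : ∀ s : ℝ, f (-s • k) = (1 : ℝ) • f (s • k) := fun s => by
    rw [neg_smul, heven, one_smul]
  have := tendsto_div_pow_of_iteratedDeriv_eq_zero hφ 2 (fun j h1 h2 => by
    obtain rfl : j = 1 := by omega
    exact iteratedDeriv_zero_of_parity hpar hφ (by norm_num)) two_pos
  rw [iteratedDeriv_along_line hf, iteratedFDeriv_two_apply] at this
  simpa [secondDifferential] using this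

/-- The quartic part of an even function, along a direction where the quadratic part vanishes,
as a limit. -/
lemma tendsto_quartic_part {f : E → ℝ} (hf : ContDiff ℝ ∞ f) (heven : ∀ k, f (-k) = f k)
    {k : E} (hk : secondDifferential f k k = 0) :
    Tendsto (fun s : ℝ => (f (s • k) - f 0) / s ^ 4) (𝓝[≠] 0)
      (𝓝 (1 / 24 * iteratedFDeriv ℝ 4 f 0 fun _ => k)) := by
  have hφ : ContDiff ℝ ∞ fun s : ℝ => f (s • k) := hf.comp (by fun_prop)
  have hpar : ∀ s : ℝ, f (-s • k) = (1 : ℝ) • f (s • k) := fun s => by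
    rw [neg_smul, heven, one_smul]
  have := tendsto_div_pow_of_iteratedDeriv_eq_zero hφ 4 (fun j h1 h2 => by
    obtain rfl | rfl | rfl : j = 1 ∨ j = 2 ∨ j = 3 := by omega
    · exact iteratedDeriv_zero_of_parity hpar hφ (by norm_num)
    · rw [iteratedDeriv_along_line hf, iteratedFDeriv_two_apply]
      exact hk
    · exact iteratedDeriv_zero_of_parity hpar hφ (by norm_num)) four_pos
  rw [iteratedDeriv_along_line hf] at this
  simpa [Nat.factorial] using this

/-- The space of smooth real functions. -/
def smoothFunctions (E : Type*) [NormedAddCommGroup E] [NormedSpace ℝ E] :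
    Submodule ℝ (E → ℝ) where
  carrier := {f | ContDiff ℝ ∞ f}
  add_mem' {f g} (hf : ContDiff ℝ ∞ f) (hg : ContDiff ℝ ∞ g) := hf.add hg
  zero_mem' := show ContDiff ℝ ∞ fun _ : E => (0 : ℝ) from contDiff_const
  smul_mem' c f (hf : ContDiff ℝ ∞ f) := hf.const_smul c

lemma smoothFunctions.contDiff (f : smoothFunctions E) : ContDiff ℝ ∞ f.1 := f.2

/-- The directional derivative along `v`, as an operator on smooth functions. -/
noncomputable def directionalDeriv (v : E) : smoothFunctions E →ₗ[ℝ] smoothFunctions E where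
  toFun f := ⟨fun x => fderiv ℝ f.1 x v,
    ((smoothFunctions.contDiff f).fderiv_right (m := ∞) (by simp)).clm_apply contDiff_const⟩
  map_add' f g := by
    ext x
    have hf : DifferentiableAt ℝ f.1 x := ((smoothFunctions.contDiff f).differentiable (by simp)) x
    have hg : DifferentiableAt ℝ g.1 x := ((smoothFunctions.contDiff g).differentiable (by simp)) x
    simp [fderiv_add hf hg]
  map_smul' c f := by
    ext x
    have hf : DifferentiableAt ℝ f.1 x := ((smoothFunctions.contDiff f).differentiable (by simp)) x
    simp [fderiv_const_smul hf]

lemma directionalDeriv_combination (x y : ℝ) (a b : E) :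
    directionalDeriv (x • a + y • b) = x • directionalDeriv a + y • directionalDeriv b := by
  ext f p
  simp [directionalDeriv]

lemma directionalDeriv_commute (a b : E) :
    directionalDeriv a * directionalDeriv b = directionalDeriv b * directionalDeriv a := by
  have key : ∀ (f : smoothFunctions E) (p v w : E),
      fderiv ℝ (fun x => fderiv ℝ f.1 x w) p v = fderiv ℝ (fderiv ℝ f.1) p v w := by
    intro f p v w
    have h1 : DifferentiableAt ℝ (fderiv ℝ f.1) p :=
      (((smoothFunctions.contDiff f).fderiv_right (m := ∞) (by simp)).differentiable (by simp)) p
    rw [fderiv_clm_apply h1 (differentiableAt_const w)]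
    simp
  ext f p
  have hle : ∀ n : ℕ, (n : WithTop ℕ∞) ≤ ∞ := fun n => by exact_mod_cast le_top
  have hs : IsSymmSndFDerivAt ℝ f.1 p :=
    (smoothFunctions.contDiff f).contDiffAt.isSymmSndFDerivAt (n := ∞)
      (by simpa using hle 2)
  have e1 := key f p a b
  have e2 := key f p b a
  have := hs a b
  rw [← e1, ← e2] at this
  exact this

lemma iteratedFDeriv_eq_directionalDeriv (f : smoothFunctions E) (p a b c d : E) :
    iteratedFDeriv ℝ 4 f.1 p ![a, b, c, d] = ((directionalDeriv a * directionalDeriv b *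
      directionalDeriv c * directionalDeriv d) f).1 p := by
  have hstep : ∀ (n : ℕ) (v : E) (m : Fin n → E) (p : E),
      iteratedFDeriv ℝ (n + 1) f.1 p (Matrix.vecCons v m) =
        fderiv ℝ (fun y => iteratedFDeriv ℝ n f.1 y m) p v := by
    intro n v m p
    have h1 : DifferentiableAt ℝ (iteratedFDeriv ℝ n f.1) p :=
      (ContDiff.differentiable_iteratedFDeriv (n := ∞) (m := n)
        (by exact_mod_cast ENat.natCast_lt_top n) (smoothFunctions.contDiff f)) p
    rw [h1.iteratedFDeriv_succ_apply_left']
    simp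
  rw [hstep]
  simp_rw [hstep]
  simp only [iteratedFDeriv_zero_apply]
  rfl

/-- The fourth differential on the plane spanned by `a` and `b`, expanded by symmetry. -/
lemma iteratedFDeriv_four_combination {f : E → ℝ} (hf : ContDiff ℝ ∞ f) (a b : E) (x y : ℝ) :
    iteratedFDeriv ℝ 4 f 0 (fun _ => x • a + y • b) =
      x ^ 4 * iteratedFDeriv ℝ 4 f 0 ![a, a, a, a]
      + 4 * x ^ 3 * y * iteratedFDeriv ℝ 4 f 0 ![a, a, a, b]
      + 6 * x ^ 2 * y ^ 2 * iteratedFDeriv ℝ 4 f 0 ![a, a, b, b]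
      + 4 * x * y ^ 3 * iteratedFDeriv ℝ 4 f 0 ![a, b, b, b]
      + y ^ 4 * iteratedFDeriv ℝ 4 f 0 ![b, b, b, b] := by
  obtain ⟨F, rfl⟩ : ∃ F : smoothFunctions E, F.1 = f := ⟨⟨f, hf⟩, rfl⟩
  have hv : (fun _ : Fin 4 => x • a + y • b) =
      ![x • a + y • b, x • a + y • b, x • a + y • b, x • a + y • b] := by
    ext i
    fin_cases i <;> rfl
  rw [hv]
  simp only [iteratedFDeriv_eq_directionalDeriv, directionalDeriv_combination]
  set P := directionalDeriv a
  set Q := directionalDeriv b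
  have hc : Q * P = P * Q := directionalDeriv_commute b a
  have h2 : (x • P + y • Q) * (x • P + y • Q) =
      x ^ 2 • (P * P) + (2 * x * y) • (P * Q) + y ^ 2 • (Q * Q) := by
    simp only [add_mul, mul_add, smul_mul_smul_comm, hc]
    module
  have hc2 : Q * Q * P = P * Q * Q := by rw [mul_assoc, hc, ← mul_assoc, hc]
  have h3 : (x • P + y • Q) * (x • P + y • Q) * (x • P + y • Q) =
      x ^ 3 • (P * P * P) + (3 * x ^ 2 * y) • (P * P * Q) + (3 * x * y ^ 2) • (P * Q * Q)
        + y ^ 3 • (Q * Q * Q) := by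
    have e : P * Q * P = P * P * Q := by rw [mul_assoc, hc, ← mul_assoc]
    rw [h2]
    simp only [add_mul, mul_add, smul_mul_smul_comm, hc2, e]
    module
  have h4 : (x • P + y • Q) * (x • P + y • Q) * (x • P + y • Q) * (x • P + y • Q) =
      x ^ 4 • (P * P * P * P) + (4 * x ^ 3 * y) • (P * P * P * Q)
        + (6 * x ^ 2 * y ^ 2) • (P * P * Q * Q) + (4 * x * y ^ 3) • (P * Q * Q * Q)
        + y ^ 4 • (Q * Q * Q * Q) := by
    have e1 : P * P * Q * P = P * P * P * Q := by rw [mul_assoc, hc, ← mul_assoc]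
    have e2 : P * Q * Q * P = P * P * Q * Q := by
      rw [mul_assoc P Q Q, mul_assoc P, hc2, ← mul_assoc, ← mul_assoc]
    have e3 : Q * Q * Q * P = P * Q * Q * Q := by
      rw [mul_assoc Q Q Q, mul_assoc Q, hc2, ← mul_assoc, ← mul_assoc, hc]
    rw [h3]
    simp only [add_mul, mul_add, smul_mul_smul_comm, e1, e2, e3]
    module
  rw [h4]
  simp

end Jets

/-! ### Linear coordinates -/

/-- The linear isomorphism which sends `((x, y), z)` to the vector with coordinates
`p x + q y`, `r x + s y`, `z`. -/
noncomputable def planeEquiv {m : ℕ} (p q r s : ℝ) (h : p * s - q * r ≠ 0) :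
    ((ℝ × ℝ) × (Fin m → ℝ)) ≃L[ℝ] (Fin (m + 2) → ℝ) :=
  LinearEquiv.toContinuousLinearEquiv
  { toFun := fun k => Matrix.vecCons (p * k.1.1 + q * k.1.2)
      (Matrix.vecCons (r * k.1.1 + s * k.1.2) k.2)
    invFun := fun v => (((s * v 0 - q * v 1) / (p * s - q * r),
      (p * v 1 - r * v 0) / (p * s - q * r)), fun i => v i.succ.succ)
    map_add' := fun k k' => by
      ext i
      refine Fin.cases ?_ (fun i => Fin.cases ?_ (fun i => ?_) i) i <;> simp <;> ring
    map_smul' := fun c k => by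
      ext i
      refine Fin.cases ?_ (fun i => Fin.cases ?_ (fun i => ?_) i) i <;> simp <;> ring
    left_inv := fun k => by
      ext i
      · simp only [Matrix.cons_val_zero, Matrix.cons_val_one]
        rw [div_eq_iff h]
        ring
      · simp only [Matrix.cons_val_zero, Matrix.cons_val_one]
        rw [div_eq_iff h]
        ring
      · simp
    right_inv := fun v => by
      ext i
      refine Fin.cases ?_ (fun i => Fin.cases ?_ (fun i => ?_) i) i
      · simp only [Matrix.cons_val_zero]
        rw [mul_div_assoc', mul_div_assoc', ← add_div, div_eq_iff h]
        ring
      · beta_reduce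
        rw [Matrix.cons_val_succ, Matrix.cons_val_zero, Fin.succ_zero_eq_one, mul_div_assoc',
          mul_div_assoc', ← add_div, div_eq_iff h]
        ring
      · simp }

lemma planeEquiv_apply {m : ℕ} (p q r s : ℝ) (h : p * s - q * r ≠ 0)
    (k : (ℝ × ℝ) × (Fin m → ℝ)) : planeEquiv p q r s h k =
      Matrix.vecCons (p * k.1.1 + q * k.1.2) (Matrix.vecCons (r * k.1.1 + s * k.1.2) k.2) := rfl

lemma vecCons_plane {m : ℕ} (x y : ℝ) :
    (Matrix.vecCons x (Matrix.vecCons y (0 : Fin m → ℝ)) : Fin (m + 2) → ℝ) =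
      x • Pi.single (0 : Fin (m + 2)) (1 : ℝ) + y • Pi.single (1 : Fin (m + 2)) (1 : ℝ) := by
  ext i
  refine Fin.cases ?_ (fun i => Fin.cases ?_ (fun i => ?_) i) i
  · simp
  · simp
  · have h1 : i.succ.succ ≠ (1 : Fin (m + 2)) := by
      rw [← Fin.succ_zero_eq_one]
      exact fun h => Fin.succ_ne_zero _ (Fin.succ_injective _ h)
    simp [Fin.succ_ne_zero, h1]

/-- Odd diffeomorphism germs may be transported by linear isomorphisms of source and target. -/
lemma IsOddDiffeoGerm.comp_linear {X Y : Type*} [NormedAddCommGroup X] [NormedSpace ℝ X]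
    [NormedAddCommGroup Y] [NormedSpace ℝ Y] {h : X → X} (hh : IsOddDiffeoGerm h)
    (e e' : X ≃L[ℝ] Y) : IsOddDiffeoGerm fun v => e (h (e'.symm v)) := by
  have ht : ∀ e : X ≃L[ℝ] Y, Tendsto e.symm (𝓝 0) (𝓝 0) := fun e => by
    simpa using e.symm.continuous.tendsto 0
  have hsm : ∀ {h : X → X} (e e' : X ≃L[ℝ] Y), SmoothNearZero h →
      SmoothNearZero fun v => e (h (e'.symm v)) := by
    intro h e e' hs
    filter_upwards [(ht e').eventually hs] with v hv
    exact e.contDiff.contDiffAt.comp v (hv.comp v e'.symm.contDiff.contDiffAt)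
  obtain ⟨g, hg0, hgs, hgh, hhg⟩ := hh.exists_inverse
  refine ⟨by simp [hh.map_zero], ?_, hsm e e' hh.smooth, fun v => e' (g (e.symm v)),
    by simp [hg0], hsm e' e hgs, ?_, ?_⟩
  · filter_upwards [(ht e').eventually hh.odd] with v hv
    rw [map_neg, hv, map_neg]
  · filter_upwards [(ht e').eventually hgh] with v hv
    simp [hv]
  · filter_upwards [(ht e).eventually hhg] with v hv
    simp [hv]

/-! ### The classification -/

section Classification

variable {m : ℕ}

/-- The fourth order part of `f` on the coordinate plane, as a binary quartic form. -/
noncomputable def planeQuartic (f : (Fin (m + 2) → ℝ) → ℝ) : ℝ → ℝ → ℝ :=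
  binaryQuartic
    (1 / 24 * partialFour f 0 0 0 0)
    (1 / 6 * partialFour f 0 0 0 1)
    (1 / 4 * partialFour f 0 0 1 1)
    (1 / 6 * partialFour f 0 1 1 1)
    (1 / 24 * partialFour f 1 1 1 1)

lemma planeQuartic_congr {f g : (Fin (m + 2) → ℝ) → ℝ} (h : g =ᶠ[𝓝 0] f) :
    planeQuartic g = planeQuartic f := by
  simp only [planeQuartic, partialFour, (h.iteratedFDeriv ℝ 4).eq_of_nhds]

lemma secondDifferential_congr {f g : (Fin (m + 2) → ℝ) → ℝ} (h : g =ᶠ[𝓝 0] f) :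
    secondDifferential g = secondDifferential f := by
  simp only [secondDifferential, h.fderiv.fderiv_eq]

/-- On the plane, the fourth order part of `f` is the limit of its rescalings; in this form it is
easily followed through changes of variables. -/
lemma tendsto_planeQuartic {f : (Fin (m + 2) → ℝ) → ℝ} (hf : ContDiff ℝ ∞ f)
    (heven : ∀ k, f (-k) = f k) {x y : ℝ}
    (h : secondDifferential f (Matrix.vecCons x (Matrix.vecCons y 0)) = 0) :
    Tendsto (fun s : ℝ => (f (s • Matrix.vecCons x (Matrix.vecCons y 0)) - f 0) / s ^ 4) (𝓝[≠] 0)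
      (𝓝 (planeQuartic f x y)) := by
  have h1 := tendsto_quartic_part hf heven (k := Matrix.vecCons x (Matrix.vecCons y 0))
    (by rw [h]; rfl)
  convert! h1 using 2
  rw [vecCons_plane, iteratedFDeriv_four_combination hf]
  simp only [planeQuartic, binaryQuartic, partialFour]
  ring

lemma secondDifferential_symm {f : (Fin (m + 2) → ℝ) → ℝ} (hf : ContDiff ℝ ∞ f)
    (v w : Fin (m + 2) → ℝ) : secondDifferential f v w = secondDifferential f w v := by
  have hle : ∀ n : ℕ, (n : WithTop ℕ∞) ≤ ∞ := fun n => by exact_mod_cast le_top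
  exact (hf.contDiffAt (x := 0)).isSymmSndFDerivAt (n := ∞) (by simpa using hle 2) v w

lemma secondDifferential_add_self {f : (Fin (m + 2) → ℝ) → ℝ} (hf : ContDiff ℝ ∞ f)
    {u : Fin (m + 2) → ℝ} (hu : secondDifferential f u = 0) (v : Fin (m + 2) → ℝ) :
    secondDifferential f (u + v) (u + v) = secondDifferential f v v := by
  have h := secondDifferential_symm hf v u
  simp only [map_add, add_apply, h, hu, zero_apply]
  simp

lemma mem_plane_iff (v : Fin (m + 2) → ℝ) :
    v ∈ Submodule.span ℝ {Pi.single (0 : Fin (m + 2)) (1 : ℝ), Pi.single (1 : Fin (m + 2)) (1 : ℝ)}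
      ↔ ∃ x y : ℝ, v = Matrix.vecCons x (Matrix.vecCons y 0) := by
  rw [Submodule.mem_span_pair]
  simp only [vecCons_plane, eq_comm]

/-- If the quartic part of `f` on the plane is linearly equivalent to a normal form, then `f` is
equivalent to this normal form plus a quadratic form. -/
lemma isXe5_of_linearlyEquivalent {f : (Fin (m + 2) → ℝ) → ℝ}
    (hsmooth : SmoothNearZero f) (heven : EvenNearZero f)
    (hker : LinearMap.ker (secondDifferential f).toLinearMap =
      Submodule.span ℝ {Pi.single (0 : Fin (m + 2)) (1 : ℝ), Pi.single (1 : Fin (m + 2)) (1 : ℝ)})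
    {ε η : ℤˣ} {a : ℝ} (ha : ε = η → a ^ 2 ≠ 4)
    (hq : LinearlyEquivalent (planeQuartic f) (normalQuartic ε η a)) : IsXe5 ε η f := by
  obtain ⟨F, hF, hFe, hFf⟩ := exists_global_representative hsmooth (c := 1) (by norm_num)
    (by simpa [EvenNearZero] using heven)
  replace hFe : ∀ k, F (-k) = F k := by simpa using hFe
  rw [← secondDifferential_congr hFf] at hker
  rw [← planeQuartic_congr hFf] at hq
  have hker' : ∀ v, secondDifferential F v = 0 ↔
      ∃ x y : ℝ, v = Matrix.vecCons x (Matrix.vecCons y 0) := fun v => by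
    rw [← mem_plane_iff, ← hker]
    rfl
  have hpl : ∀ x y : ℝ, secondDifferential F (Matrix.vecCons x (Matrix.vecCons y 0)) = 0 :=
    fun x y => (hker' _).mpr ⟨x, y, rfl⟩
  have hsymm := secondDifferential_symm hF
  obtain ⟨p, q, r, s, hd, hq⟩ := hq
  set A := planeEquiv (m := m) p q r s hd with hA
  set A₀ := planeEquiv (m := m) 1 0 0 1 (by norm_num) with hA₀
  -- half the second differential, restricted to the complementary coordinate subspace
  set ι : (Fin m → ℝ) →L[ℝ] (Fin (m + 2) → ℝ) :=
    (A₀ : _ →L[ℝ] _) ∘L ContinuousLinearMap.inr ℝ (ℝ × ℝ) (Fin m → ℝ) with hι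
  have hιz : ∀ z, ι z = Matrix.vecCons 0 (Matrix.vecCons 0 z) := fun z => by
    simp [hι, hA₀, planeEquiv_apply]
  have hsplit : ∀ (x y : ℝ) (z : Fin m → ℝ), Matrix.vecCons x (Matrix.vecCons y z) =
      Matrix.vecCons x (Matrix.vecCons y 0) + ι z := fun x y z => by
    rw [hιz]
    simp
  set b : (Fin m → ℝ) →ₗ[ℝ] (Fin m → ℝ) →L[ℝ] ℝ :=
    { toFun := fun z => (1 / 2 : ℝ) • (secondDifferential F (ι z) ∘L ι)
      map_add' := fun z z' => by ext; simp
      map_smul' := fun c z => by ext; simp; ring } with hb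
  have hbz : ∀ z z', b z z' = 1 / 2 * secondDifferential F (ι z) (ι z') := fun z z' => by
    simp [hb]
  have hbinj : Function.Injective b := by
    rw [← LinearMap.ker_eq_bot, LinearMap.ker_eq_bot']
    intro z hz
    have h0 : secondDifferential F (ι z) = 0 := by
      ext v
      obtain ⟨k, rfl⟩ := A₀.surjective v
      have e1 : A₀ k = Matrix.vecCons k.1.1 (Matrix.vecCons k.1.2 k.2) := by
        simp [hA₀, planeEquiv_apply]
      have e2 : b z k.2 = 0 := by rw [hz]; rfl
      rw [hbz] at e2
      rw [e1, hsplit, map_add, hsymm (ι z), hpl]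
      simp at e2 ⊢
      exact e2
    obtain ⟨x, y, hxy⟩ := (hker' _).mp h0
    rw [hιz] at hxy
    ext i
    have := congrFun hxy i.succ.succ
    simpa using this
  have hdim : Module.finrank ℝ (Fin m → ℝ) = Module.finrank ℝ ((Fin m → ℝ) →L[ℝ] ℝ) := by
    rw [← LinearEquiv.finrank_eq (LinearMap.toContinuousLinearMap (𝕜 := ℝ) (E := Fin m → ℝ)
      (F' := ℝ))]
    exact Subspace.dual_finrank_eq.symm
  set B : (Fin m → ℝ) ≃L[ℝ] ((Fin m → ℝ) →L[ℝ] ℝ) :=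
    (b.linearEquivOfInjective hbinj hdim).toContinuousLinearEquiv with hB
  have hBb : ∀ z z', B z z' = b z z' := fun z z' => rfl
  have hBsymm : ∀ z z', B z z' = B z' z := fun z z' => by
    rw [hBb, hBb, hbz, hbz, hsymm]
  -- the function in the new linear coordinates
  have h0 : F 0 = f 0 := hFf.eq_of_nhds
  have hA0 : F (A 0) = F 0 := by rw [map_zero]
  obtain ⟨h, hh, hnf⟩ := exists_oddDiffeo_normalForm (f := fun k => F (A k))
    (hF.comp A.contDiff) (fun k => by rw [map_neg, hFe]) B hBsymm
    (fun k => by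
      have h1 := tendsto_quadratic_part hF hFe (A k)
      have h2 : 1 / 2 * secondDifferential F (A k) (A k) = B k.2 k.2 := by
        rw [hBb, hbz, hA, planeEquiv_apply, hsplit, secondDifferential_add_self hF (hpl _ _)]
      rw [h2] at h1
      simpa only [map_smul, hA0] using h1)
    ha
    (fun u => by
      have h1 := tendsto_planeQuartic hF hFe (hpl (p * u.1 + q * u.2) (r * u.1 + s * u.2))
      rw [hq] at h1
      have h2 : A (u, 0) = Matrix.vecCons (p * u.1 + q * u.2)
        (Matrix.vecCons (r * u.1 + s * u.2) 0) := rfl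
      simpa only [map_smul, hA0, h2] using h1)
  refine ⟨a, f 0, LinearMap.BilinMap.toQuadraticMap
    ((ContinuousLinearMap.coeLM ℝ) ∘ₗ b), ha, ?_, fun v => A₀ (h (A.symm v)),
    hh.comp_linear A₀ A, ?_⟩
  · rw [QuadraticMap.nondegenerate_iff_radical_eq_bot, eq_bot_iff]
    intro z hz
    rw [QuadraticMap.mem_radical_iff'] at hz
    obtain ⟨hz0, hz⟩ := hz
    have hz0' : b z z = 0 := hz0
    have hz' : ∀ n, b (z + n) (z + n) = b n n := hz
    refine (Submodule.mem_bot ℝ).mpr (hbinj ?_)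
    rw [map_zero]
    ext1 n
    have h1 := hz' n
    have h2 := hBsymm n z
    rw [hBb, hBb] at h2
    simp only [map_add, add_apply] at h1
    change b z n = 0
    linarith
  · have ht : Tendsto A.symm (𝓝 0) (𝓝 0) := by
      simpa using A.symm.continuous.tendsto 0
    filter_upwards [ht.eventually hnf, hFf] with v hv hv'
    rw [ContinuousLinearEquiv.apply_symm_apply, hA0, h0, hv'] at hv
    rw [hv]
    simp only [Function.comp_apply, xe5NormalForm, hA₀, planeEquiv_apply]
    have e1 : ∀ z, LinearMap.BilinMap.toQuadraticMap ((ContinuousLinearMap.coeLM ℝ) ∘ₗ b) z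
      = B z z := fun z => rfl
    rw [e1]
    simp [normalQuartic, binaryQuartic]
    ring

/-- In the class `X_{e,5}` the quartic part on the plane is linearly equivalent to the quartic
part of the normal form; the linear substitution is the restriction to the plane of the derivative
at `0` of the change of variables. -/
lemma linearlyEquivalent_of_isXe5 {f : (Fin (m + 2) → ℝ) → ℝ}
    (hsmooth : SmoothNearZero f) (heven : EvenNearZero f)
    (hker : LinearMap.ker (secondDifferential f).toLinearMap =
      Submodule.span ℝ {Pi.single (0 : Fin (m + 2)) (1 : ℝ), Pi.single (1 : Fin (m + 2)) (1 : ℝ)})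
    {ε η : ℤˣ} (hX : IsXe5 ε η f) : ∃ a : ℝ, (ε = η → a ^ 2 ≠ 4) ∧
      LinearlyEquivalent (normalQuartic ε η a) (planeQuartic f) := by
  obtain ⟨a, d, Q, ha, hQ, h, hh, hfh⟩ := hX
  refine ⟨a, ha, ?_⟩
  obtain ⟨F, hF, hFe, hFf⟩ := exists_global_representative hsmooth (c := 1) (by norm_num)
    (by simpa [EvenNearZero] using heven)
  replace hFe : ∀ k, F (-k) = F k := by simpa using hFe
  obtain ⟨H, hH, hHo, hHh⟩ := exists_global_representative hh.smooth (c := -1) (by norm_num)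
    (by simpa using hh.odd)
  rw [← secondDifferential_congr hFf] at hker
  rw [← planeQuartic_congr hFf]
  have hpl : ∀ x y : ℝ, secondDifferential F (Matrix.vecCons x (Matrix.vecCons y 0)) = 0 := by
    intro x y
    have h1 := (mem_plane_iff (Matrix.vecCons x (Matrix.vecCons y (0 : Fin m → ℝ)))).mpr
      ⟨x, y, rfl⟩
    rw [← hker] at h1
    exact h1
  have hsymm := secondDifferential_symm hF
  have hFN : F =ᶠ[𝓝 0] fun k => xe5NormalForm ε η a d Q (H k) := by
    filter_upwards [hFf, hfh, hHh] with k h1 h2 h3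
    rw [h1, h2, Function.comp_apply, h3]
  have hH0 : H 0 = 0 := by rw [hHh.eq_of_nhds, hh.map_zero]
  have hF0 : F 0 = d := by
    have : Q (fun _ : Fin m => 0) = 0 := QuadraticMap.map_zero Q
    rw [hFN.eq_of_nhds, hH0]
    simp [xe5NormalForm, this]
  -- the derivative `L` of the change of variables at the origin is bijective
  set L := fderiv ℝ H 0 with hL
  have hHd : HasFDerivAt H L 0 := (hH.differentiable (by simp) 0).hasFDerivAt
  obtain ⟨g, hg0, hgs, hgh, hhg⟩ := hh.exists_inverse
  have hgd := (hgs.self_of_nhds.differentiableAt (by simp)).hasFDerivAt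
  set G := fderiv ℝ g 0 with hG
  have hGL : G ∘L L = ContinuousLinearMap.id ℝ _ := by
    have h1 : HasFDerivAt (g ∘ H) (G ∘L L) 0 := HasFDerivAt.comp 0 (by rwa [hH0]) hHd
    have h2 : g ∘ H =ᶠ[𝓝 0] id := by
      filter_upwards [hgh, hHh] with k h1 h2
      rw [Function.comp_apply, h2, h1, id]
    exact h1.unique ((hasFDerivAt_id _).congr_of_eventuallyEq h2)
  have hLinj : Function.Injective L := Function.LeftInverse.injective
    (g := G) fun v => by simpa using congrArg (fun T => T v) hGL
  have hLsurj : Function.Surjective L :=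
    (LinearMap.injective_iff_surjective (f := L.toLinearMap)).mp hLinj
  -- first order behaviour along rays
  have hray : ∀ (k : Fin (m + 2) → ℝ) (i : Fin (m + 2)),
      Tendsto (fun s : ℝ => H (s • k) i / s) (𝓝[≠] 0) (𝓝 (L k i)) := by
    intro k i
    have h1 : HasDerivAt (fun s : ℝ => H (s • k)) (L k) 0 := by
      have h2 : HasDerivAt (fun s : ℝ => s • k) k 0 := by
        simpa using (hasDerivAt_id (0 : ℝ)).smul_const k
      exact HasFDerivAt.comp_hasDerivAt (l := H) (l' := L) 0 (by simpa using hHd) h2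
    have h3 := (hasDerivAt_iff_tendsto_slope.mp ((hasDerivAt_pi.mp h1) i))
    refine h3.congr fun s => ?_
    simp [slope, hH0]
    ring
  have hsmall : ∀ k : Fin (m + 2) → ℝ, Tendsto (fun s : ℝ => s • k) (𝓝[≠] 0) (𝓝 0) := by
    intro k
    have : Continuous fun s : ℝ => s • k := by fun_prop
    simpa using (this.tendsto 0).mono_left nhdsWithin_le_nhds
  have hid : Tendsto (fun s : ℝ => s) (𝓝[≠] 0) (𝓝 0) := tendsto_id.mono_left nhdsWithin_le_nhds
  set z : (Fin (m + 2) → ℝ) → Fin m → ℝ := fun k i => k i.succ.succ with hz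
  have hQc : Continuous Q := by
    have h1 : Continuous fun v : Fin m → ℝ =>
        (QuadraticMap.associated (R := ℝ) Q).toContinuousBilinearMap v v := by fun_prop
    refine h1.congr fun v => ?_
    rw [LinearMap.toContinuousBilinearMap_apply]
    exact QuadraticMap.associated_eq_self_apply ℝ Q v
  have hQs : ∀ (c : ℝ) v, Q (fun i => v i / c) = Q v / c ^ 2 := by
    intro c v
    have h1 : (fun i => v i / c) = c⁻¹ • v := by
      ext i
      simp
      ring
    rw [h1, QuadraticMap.map_smul, smul_eq_mul]
    ring
  -- the quadratic part is transported by the derivative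
  have hquad : ∀ k, 1 / 2 * secondDifferential F k k = Q (z (L k)) := by
    intro k
    refine tendsto_nhds_unique (tendsto_quadratic_part hF hFe k) ?_
    have hz1 : Tendsto (fun s : ℝ => fun i => z (H (s • k)) i / s) (𝓝[≠] 0) (𝓝 (z (L k))) :=
      tendsto_pi_nhds.mpr fun i => hray k i.succ.succ
    have hx := hray k 0
    have hy := hray k 1
    have := (((((hx.pow 4).const_mul ((ε : ℤ) : ℝ)).add
      (((hx.pow 2).const_mul a).mul (hy.pow 2))).add
      ((hy.pow 4).const_mul ((η : ℤ) : ℝ))).mul (hid.pow 2)).add ((hQc.tendsto _).comp hz1)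
    have e0 : ∀ t : ℝ, t * (0 : ℝ) ^ 2 + Q (z (L k)) = Q (z (L k)) := fun t => by ring
    rw [e0] at this
    refine this.congr' ?_
    filter_upwards [self_mem_nhdsWithin, (hsmall k).eventually hFN] with s hs hs'
    have hs0 : s ≠ 0 := hs
    rw [hs', hF0]
    simp only [Function.comp_apply, hQs, xe5NormalForm]
    field_simp
    ring
  -- hence the derivative preserves the plane
  have hLplane : ∀ x y : ℝ, z (L (Matrix.vecCons x (Matrix.vecCons y 0))) = 0 := by
    intro x y
    set u : Fin (m + 2) → ℝ := Matrix.vecCons x (Matrix.vecCons y 0) with hu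
    have hrad : z (L u) ∈ Q.radical := by
      rw [QuadraticMap.mem_radical_iff']
      refine ⟨?_, fun n => ?_⟩
      · rw [← hquad, hpl]
        simp
      · obtain ⟨k, hk⟩ := hLsurj (Matrix.vecCons 0 (Matrix.vecCons 0 n))
        have hn : z (L k) = n := by rw [hk]; rfl
        have hadd : z (L u) + n = z (L (u + k)) := by rw [map_add, ← hn]; rfl
        rw [hadd, ← hn, ← hquad, ← hquad,
          secondDifferential_add_self hF (hpl x y)]
    rwa [hQ.radical_eq_bot, Submodule.mem_bot] at hrad
  -- so that only the quartic part contributes to the fourth order on the plane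
  have hquart : ∀ x y : ℝ, planeQuartic F x y = normalQuartic ε η a
      (L (Matrix.vecCons x (Matrix.vecCons y 0)) 0)
      (L (Matrix.vecCons x (Matrix.vecCons y 0)) 1) := by
    intro x y
    refine tendsto_nhds_unique (tendsto_planeQuartic hF hFe (hpl x y)) ?_
    set u : Fin (m + 2) → ℝ := Matrix.vecCons x (Matrix.vecCons y 0) with hu
    -- an odd function with vanishing derivative at `0` is `o(s²)`, so `Q` contributes `o(s⁴)`
    have hz2 : Tendsto (fun s : ℝ => fun i => z (H (s • u)) i / s ^ 2) (𝓝[≠] 0) (𝓝 0) := by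
      refine tendsto_pi_nhds.mpr fun i => ?_
      have hφ : ContDiff ℝ ∞ fun s : ℝ => H (s • u) i.succ.succ :=
        (contDiff_pi.mp hH i.succ.succ).comp (by fun_prop)
      have hpar : ∀ s : ℝ, H (-s • u) i.succ.succ = (-1 : ℝ) • H (s • u) i.succ.succ := by
        intro s
        rw [neg_smul, hHo]
        rfl
      have hd1 : iteratedDeriv 1 (fun s : ℝ => H (s • u) i.succ.succ) 0 = 0 := by
        rw [iteratedDeriv_one]
        have h2 : HasDerivAt (fun s : ℝ => s • u) u 0 := by
          simpa using (hasDerivAt_id (0 : ℝ)).smul_const u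
        have h1 : HasDerivAt (fun s : ℝ => H (s • u)) (L u) 0 :=
          HasFDerivAt.comp_hasDerivAt (l := H) (l' := L) 0 (by simpa using hHd) h2
        rw [((hasDerivAt_pi.mp h1) i.succ.succ).deriv]
        exact congrFun (hLplane x y) i
      have h2 := tendsto_div_pow_of_iteratedDeriv_eq_zero hφ 2 (fun j h1 h2 => by
        obtain rfl : j = 1 := by omega
        exact hd1) two_pos
      rw [iteratedDeriv_zero_of_parity hpar hφ (by norm_num)] at h2
      simpa [hH0] using h2
    have hx := hray u 0
    have hy := hray u 1
    have := ((((hx.pow 4).const_mul ((ε : ℤ) : ℝ)).add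
      (((hx.pow 2).const_mul a).mul (hy.pow 2))).add
      ((hy.pow 4).const_mul ((η : ℤ) : ℝ))).add ((hQc.tendsto _).comp hz2)
    have e0 : ((ε : ℤ) : ℝ) * L u 0 ^ 4 + a * L u 0 ^ 2 * L u 1 ^ 2 + ((η : ℤ) : ℝ) * L u 1 ^ 4
        + Q 0 = normalQuartic ε η a (L u 0) (L u 1) := by
      rw [QuadraticMap.map_zero]
      simp [normalQuartic, binaryQuartic]
    rw [e0] at this
    refine this.congr' ?_
    filter_upwards [self_mem_nhdsWithin, (hsmall u).eventually hFN] with s hs hs'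
    have hs0 : s ≠ 0 := hs
    rw [hs', hF0]
    simp only [Function.comp_apply, hQs, xe5NormalForm]
    field_simp
    ring
  set e₀ : Fin (m + 2) → ℝ := Pi.single 0 1 with he₀
  set e₁ : Fin (m + 2) → ℝ := Pi.single 1 1 with he₁
  have hlin : ∀ (x y : ℝ) (i : Fin (m + 2)), L (Matrix.vecCons x (Matrix.vecCons y 0)) i =
      L e₀ i * x + L e₁ i * y := by
    intro x y i
    rw [vecCons_plane, map_add, map_smul, map_smul]
    simp [he₀, he₁]
    ring
  refine ⟨L e₀ 0, L e₁ 0, L e₀ 1, L e₁ 1, fun hdet => ?_, fun x y => ?_⟩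
  · -- a vector of the plane killed by the derivative vanishes
    have hzero : ∀ x y : ℝ, L e₀ 0 * x + L e₁ 0 * y = 0 → L e₀ 1 * x + L e₁ 1 * y = 0 →
        x = 0 ∧ y = 0 := by
      intro x y h0 h1
      have hv : L (Matrix.vecCons x (Matrix.vecCons y 0)) = 0 := by
        ext i
        refine Fin.cases ?_ (fun i => Fin.cases ?_ (fun i => ?_) i) i
        · rw [hlin, h0]; rfl
        · rw [Fin.succ_zero_eq_one, hlin, h1]; rfl
        · exact congrFun (hLplane x y) i
      have hv0 := hLinj (hv.trans (map_zero L).symm)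
      exact ⟨by simpa using congrFun hv0 0, by simpa using congrFun hv0 1⟩
    obtain ⟨h1, h2⟩ := hzero (L e₁ 1) (-L e₀ 1) (by linear_combination hdet) (by ring)
    obtain ⟨h3, h4⟩ := hzero (L e₁ 0) (-L e₀ 0) (by ring) (by linear_combination -hdet)
    have := (hzero 1 0 (by linarith) (by linarith)).1
    exact one_ne_zero this
  · rw [hquart, hlin, hlin]

end Classification

theorem mainTheorem7 {m : ℕ} (f : (Fin (m + 2) → ℝ) → ℝ)
    (hsmooth : SmoothNearZero f) (heven : EvenNearZero f)
    (hker : LinearMap.ker (secondDifferential f).toLinearMap =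
      Submodule.span ℝ {Pi.single (0 : Fin (m + 2)) (1 : ℝ), Pi.single (1 : Fin (m + 2)) (1 : ℝ)}) :
    ((∃ ε η : ℤˣ, IsXe5 ε η f) ↔ deltaFour f ≠ 0) ∧
    (0 < deltaFour f → IsXe5 1 1 f ∨ IsXe5 (-1) (-1) f) ∧
    (deltaFour f < 0 → IsXe5 1 (-1) f) := by
  -- for nonzero discriminant, the sign `ε η` of the normal form is the sign of the discriminant
  have hforward : deltaFour f ≠ 0 → ∃ (ε η : ℤˣ) (a : ℝ), (ε = η → a ^ 2 ≠ 4) ∧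
      LinearlyEquivalent (planeQuartic f) (normalQuartic ε η a) ∧
      0 < (((ε * η : ℤˣ) : ℤ) : ℝ) * deltaFour f := by
    intro hne
    obtain ⟨ε, η, a, hq⟩ := exists_normalQuartic hne
    refine ⟨ε, η, a, ?_, hq, ?_⟩ <;> obtain ⟨p, q, r, s, hd, hq⟩ := hq <;>
      have hdisc := quarticDiscriminant_comp hq <;> rw [quarticDiscriminant_normal] at hdisc
    · rintro rfl ha
      have := mul_ne_zero (pow_ne_zero 12 hd) hne
      apply this
      rw [deltaFour, ← hdisc, ha]
      simp
    · have h1 : 0 < (p * s - q * r) ^ 12 * deltaFour f ^ 2 := by positivity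
      have h2 : (((ε * η : ℤˣ) : ℤ) : ℝ) ^ 2 = 1 := sq_intCast_units _
      have hdisc' : 16 * (((ε * η : ℤˣ) : ℤ) : ℝ) *
          (a ^ 2 - 4 * (((ε * η : ℤˣ) : ℤ) : ℝ)) ^ 2 = (p * s - q * r) ^ 12 * deltaFour f := hdisc
      generalize (((ε * η : ℤˣ) : ℤ) : ℝ) = σ at h2 hdisc' ⊢
      have h3 : 16 * (a ^ 2 - 4 * σ) ^ 2 * (σ * deltaFour f) =
          (p * s - q * r) ^ 12 * deltaFour f ^ 2 := by linear_combination deltaFour f * hdisc'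
      rw [← h3] at h1
      exact pos_of_mul_pos_right h1 (by positivity)
  refine ⟨⟨?_, fun hne => ?_⟩, fun hpos => ?_, fun hneg => ?_⟩
  · rintro ⟨ε, η, hX⟩
    obtain ⟨a, ha, p, q, r, s, hd, hq⟩ := linearlyEquivalent_of_isXe5 hsmooth heven hker hX
    have : deltaFour f = (p * s - q * r) ^ 12 *
      quarticDiscriminant ((ε : ℤ) : ℝ) 0 a 0 ((η : ℤ) : ℝ) := quarticDiscriminant_comp hq
    rw [this]
    exact mul_ne_zero (pow_ne_zero _ hd) (quarticDiscriminant_normal_ne_zero ha)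
  · obtain ⟨ε, η, a, ha, hq, -⟩ := hforward hne
    exact ⟨ε, η, isXe5_of_linearlyEquivalent hsmooth heven hker ha hq⟩
  · obtain ⟨ε, η, a, ha, hq, hsign⟩ := hforward hpos.ne'
    have hX := isXe5_of_linearlyEquivalent hsmooth heven hker ha hq
    rcases Int.units_eq_one_or ε with rfl | rfl <;> rcases Int.units_eq_one_or η with rfl | rfl
    · exact Or.inl hX
    · norm_num at hsign
      linarith
    · norm_num at hsign
      linarith
    · exact Or.inr hX
  · obtain ⟨ε, η, a, ha, hq, hsign⟩ := hforward hneg.ne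
    rcases Int.units_eq_one_or ε with rfl | rfl <;> rcases Int.units_eq_one_or η with rfl | rfl
    · norm_num at hsign
      linarith
    · exact isXe5_of_linearlyEquivalent hsmooth heven hker ha hq
    · -- exchange the two variables
      refine isXe5_of_linearlyEquivalent hsmooth heven hker (a := a)
        (fun h => absurd h (by decide))
        (hq.trans ⟨0, 1, 1, 0, by norm_num, fun x y => ?_⟩)
      simp only [normalQuartic, binaryQuartic]
      ring
    · norm_num at hsign
      linarith
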